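/- Let $R$ and $S$ be associative rings with unit, modules being left modules unless stated otherwise. Let $C={}_SC_R$ be a faithfully semidualizing bimodule: ${}_SC$ and $C_R$ have resolutions by finitely generated projective modules; the homothety maps $S\to\operatorname{Hom}_{R^{op}}(C,C)$ and $R\to\operatorname{Hom}_S(C,C)$ are bijective; $\operatorname{Ext}^i_S(C,C)=0=\operatorname{Ext}^i_{R^{op}}(C,C)$ for all $i\ge 1$; and, for every left $S$-module $N$ and right $R$-module $M$, $\operatorname{Hom}_S(C,N)=0$ implies $N=0$ and $\operatorname{Hom}_{R^{op}}(C,M)=0$ implies $M=0$. Let $n\ge 1$ and $k\ge 0$ be integers. A module $M$ is *finitely $n$-presented* if there is an exact sequence $F_n\to\cdots\to F_0\to M\to 0$ with all $F_i$ finitely generated free. Let $fp_nI(R)$ be the class of $R$-modules $M$ such that $\operatorname{Hom}_R(L,M)\to\operatorname{Hom}_R(K,M)$ is surjective for every monomorphism $K\to L$ of finitely $n$-presented $R$-modules, and $fp_nF(R)$ the class of $R$-modules $M$ such that $K\otimes_RM\to L\otimes_RM$ is injective for every monomorphism $K\to L$ of finitely $n$-presented right $R$-modules; $fp_nI(S)$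 is defined in the same way. Let $Cfp_nI(R)$ be the class of $R$-modules isomorphic to $\operatorname{Hom}_S(C,X)$ with $X\in fp_nI(S)$, and $Cfp_nF(S)$ the class of $S$-modules isomorphic to $C\otimes_RY$ with $Y\in fp_nF(R)$. For $\mathcal X=fp_nI(S)$ or $Cfp_nI(R)$, let $\mathcal X_{\le k}$ be the class of modules $M$ with an exact sequence $0\to M\to I_0\to\cdots\to I_k\to0$, all $I_i\in\mathcal X$; for $\mathcal X=fp_nF(R)$ or $Cfp_nF(S)$, let $\mathcal X_{\le k}$ be the class of modules $M$ with an exact sequence $0\to F_k\to\cdots\to F_0\to M\to0$, all $F_i\in\mathcal X$. The Auslander class $\mathcal A_C(R)$ consists of the $R$-modules $M$ with $\operatorname{Tor}^R_i(C,M)=0=\operatorname{Ext}_S^i(C,C\otimes_RM)$ for all $i\ge1$ for which $\mu_M:M\to\operatorname{Hom}_S(C,C\otimes_RM)$, $m\mapsto(c\mapsto c\otimes m)$, is an isomorphism. The Bass class $\mathcal B_C(S)$ consists of the $S$-modules $N$ with $\operatorname{Ext}_S^i(C,N)=0=\operatorname{Tor}^R_i(C,\operatorname{Hom}_S(C,N))$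 for all $i\ge1$ for which $\nu_N:C\otimes_R\operatorname{Hom}_S(C,N)\to N$, $c\otimes f\mapsto f(c)$, is an isomorphism. All these classes are regarded as full subcategories of the module categories. **Theorem (Foxby equivalence).** The functors $C\otimes_R-$ and $\operatorname{Hom}_S(C,-)$, with $\mu$ and $\nu$ as unit and counit, restrict to mutually quasi-inverse equivalences of categories $$fp_nF(R)\simeq Cfp_nF(S),\qquad fp_nF(R)_{\le k}\simeq Cfp_nF(S)_{\le k},\qquad \mathcal A_C(R)\simeq\mathcal B_C(S),$$ $$Cfp_nI(R)_{\le k}\simeq fp_nI(S)_{\le k},\qquad Cfp_nI(R)\simeq fp_nI(S).$$ Moreover there are inclusions of full subcategories $$fp_nF(R)\subseteq fp_nF(R)_{\le k}\subseteq\mathcal A_C(R)\supseteq Cfp_nI(R)_{\le k}\supseteq Cfp_nI(R),$$ $$Cfp_nF(S)\subseteq Cfp_nF(S)_{\le k}\subseteq\mathcal B_C(S)\supseteq fp_nI(S)_{\le k}\supseteq fp_nI(S),$$ and they commute with these equivalences. -/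

import Mathlib

open CategoryTheory MulOpposite

universe u

namespace Foxby

noncomputable section

/-! ### The tensor product over a noncommutative ring

Right `R`-modules are modules over `Rᵐᵒᵖ`; the product `c r` is `op r • c`. -/

section Tensor

open scoped TensorProduct

/-- The subgroup of `C ⊗_ℤ M` generated by all `c r ⊗ m - c ⊗ r m`. -/
def balancedRel (R C M : Type u) [Ring R] [AddCommGroup C] [Module Rᵐᵒᵖ C]
    [AddCommGroup M] [Module R M] : Submodule ℤ (C ⊗[ℤ] M) :=
  Submodule.span ℤ {t | ∃ (c : C) (r : R) (m : M), t = (op r • c) ⊗ₜ[ℤ] m - c ⊗ₜ[ℤ] (r • m)}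

/-- The abelian group `C ⊗_R M` of a right `R`-module `C` and a left `R`-module `M`. -/
def Tens (R C M : Type u) [Ring R] [AddCommGroup C] [Module Rᵐᵒᵖ C]
    [AddCommGroup M] [Module R M] : Type u :=
  (C ⊗[ℤ] M) ⧸ balancedRel R C M

namespace Tens

variable (R : Type u) [Ring R] {C C' C'' : Type u}
  [AddCommGroup C] [Module Rᵐᵒᵖ C] [AddCommGroup C'] [Module Rᵐᵒᵖ C']
  [AddCommGroup C''] [Module Rᵐᵒᵖ C'']
  {M M' M'' : Type u} [AddCommGroup M] [Module R M] [AddCommGroup M'] [Module R M']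
  [AddCommGroup M''] [Module R M'']

instance : AddCommGroup (Tens R C M) :=
  inferInstanceAs (AddCommGroup ((C ⊗[ℤ] M) ⧸ balancedRel R C M))

/-- The pure tensor `c ⊗ m` in `C ⊗_R M`. -/
def tmul (c : C) (m : M) : Tens R C M := (balancedRel R C M).mkQ (c ⊗ₜ[ℤ] m)

lemma tmul_add (c : C) (m m' : M) : tmul R c (m + m') = tmul R c m + tmul R c m' := by
  unfold tmul
  rw [TensorProduct.tmul_add, map_add]
  rfl

lemma add_tmul (c c' : C) (m : M) : tmul R (c + c') m = tmul R c m + tmul R c' m := by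
  unfold tmul
  rw [TensorProduct.add_tmul, map_add]
  rfl

lemma smul_tmul (c : C) (r : R) (m : M) : tmul R (op r • c) m = tmul R c (r • m) := by
  unfold tmul
  refine (Submodule.Quotient.eq _).2 (Submodule.subset_span ⟨c, r, m, rfl⟩)

variable {R} in
lemma induction_on {p : Tens R C M → Prop} (t : Tens R C M) (tmul : ∀ c m, p (tmul R c m))
    (add : ∀ x y, p x → p y → p (x + y)) : p t := by
  obtain ⟨t, rfl⟩ := (balancedRel R C M).mkQ_surjective t
  induction t using TensorProduct.induction_on with
  | zero => simpa [Tens.tmul] using tmul 0 0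
  | tmul c m => exact tmul c m
  | add x y hx hy =>
    rw [map_add]
    exact add _ _ hx hy

/-- The universal property: a biadditive `R`-balanced map factors through `C ⊗_R M`. -/
def lift {A : Type u} [AddCommGroup A] (f : C →+ M →+ A)
    (hf : ∀ c (r : R) m, f (op r • c) m = f c (r • m)) : Tens R C M →+ A :=
  ((balancedRel R C M).liftQ
    (TensorProduct.liftAddHom f fun z c m => by
      rw [map_zsmul, map_zsmul, AddMonoidHom.zsmul_apply]).toIntLinearMap
    (Submodule.span_le.2 (by
      rintro _ ⟨c, r, m, rfl⟩
      refine LinearMap.mem_ker.2 ?_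
      rw [map_sub, sub_eq_zero]
      exact hf c r m))).toAddMonoidHom

@[simp]
lemma lift_tmul {A : Type u} [AddCommGroup A] (f : C →+ M →+ A)
    (hf : ∀ c (r : R) m, f (op r • c) m = f c (r • m)) (c : C) (m : M) :
    lift R f hf (tmul R c m) = f c m := by
  rfl

variable {R} in
lemma hom_ext {A : Type u} [AddCommGroup A] {f g : Tens R C M →+ A}
    (h : ∀ c m, f (tmul R c m) = g (tmul R c m)) : f = g := by
  ext t
  induction t using induction_on with
  | tmul c m => exact h c m
  | add x y hx hy => rw [map_add, map_add, hx, hy]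

/-- The map `f ⊗ g : C ⊗_R M → C' ⊗_R M'`. -/
def map (f : C →ₗ[Rᵐᵒᵖ] C') (g : M →ₗ[R] M') : Tens R C M →+ Tens R C' M' :=
  lift R (AddMonoidHom.mk' (fun c => AddMonoidHom.mk' (fun m => tmul R (f c) (g m))
      (fun m m' => by rw [map_add, tmul_add]))
    (fun c c' => by ext m; simp [add_tmul]))
    (fun c r m => by simp [smul_tmul])

@[simp]
lemma map_tmul (f : C →ₗ[Rᵐᵒᵖ] C') (g : M →ₗ[R] M') (c : C) (m : M) :
    map R f g (tmul R c m) = tmul R (f c) (g m) := by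
  simp [map]

lemma map_id : map R (LinearMap.id : C →ₗ[Rᵐᵒᵖ] C) (LinearMap.id : M →ₗ[R] M) =
    AddMonoidHom.id _ :=
  hom_ext (by simp)

lemma map_comp (f : C →ₗ[Rᵐᵒᵖ] C') (g : M →ₗ[R] M') (f' : C' →ₗ[Rᵐᵒᵖ] C'')
    (g' : M' →ₗ[R] M'') :
    map R (f' ∘ₗ f) (g' ∘ₗ g) = (map R f' g').comp (map R f g) :=
  hom_ext (by simp)

variable {S : Type u} [Ring S] [Module S C] [SMulCommClass S Rᵐᵒᵖ C]

/-- The left `S`-module structure of `C ⊗_R M` for an `(S, R)`-bimodule `C`: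
`s (c ⊗ m) = (s c) ⊗ m`. -/
instance : Module S (Tens R C M) where
  smul s := map R (Module.toModuleEnd Rᵐᵒᵖ C s) LinearMap.id
  one_smul t := by
    change map R (Module.toModuleEnd Rᵐᵒᵖ C (1 : S)) LinearMap.id t = t
    rw [map_one]
    exact DFunLike.congr_fun (map_id R) t
  mul_smul s s' t := by
    change map R (Module.toModuleEnd Rᵐᵒᵖ C (s * s')) LinearMap.id t =
      map R (Module.toModuleEnd Rᵐᵒᵖ C s) LinearMap.id
        (map R (Module.toModuleEnd Rᵐᵒᵖ C s') LinearMap.id t)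
    rw [map_mul]
    exact DFunLike.congr_fun (map_comp R (Module.toModuleEnd Rᵐᵒᵖ C s') LinearMap.id
      (Module.toModuleEnd Rᵐᵒᵖ C s) LinearMap.id) t
  smul_zero s := _root_.map_zero (map R (Module.toModuleEnd Rᵐᵒᵖ C s) LinearMap.id)
  smul_add s := _root_.map_add (map R (Module.toModuleEnd Rᵐᵒᵖ C s) LinearMap.id)
  add_smul s s' t := by
    change map R (Module.toModuleEnd Rᵐᵒᵖ C (s + s')) LinearMap.id t =
      map R (Module.toModuleEnd Rᵐᵒᵖ C s) LinearMap.id t +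
        map R (Module.toModuleEnd Rᵐᵒᵖ C s') LinearMap.id t
    refine DFunLike.congr_fun (hom_ext (f := map R (Module.toModuleEnd Rᵐᵒᵖ C (s + s'))
      LinearMap.id) (g := map R (Module.toModuleEnd Rᵐᵒᵖ C s) LinearMap.id +
        map R (Module.toModuleEnd Rᵐᵒᵖ C s') LinearMap.id) ?_) t
    intro c m
    simp [add_smul, add_tmul]
  zero_smul t := by
    change map R (Module.toModuleEnd Rᵐᵒᵖ C (0 : S)) LinearMap.id t = 0
    refine DFunLike.congr_fun (hom_ext (f := map R (Module.toModuleEnd Rᵐᵒᵖ C (0 : S))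
      LinearMap.id) (g := 0) ?_) t
    intro c m
    have h := add_tmul R (0 : C) 0 m
    rw [add_zero] at h
    simpa using h

lemma smul_def (s : S) (c : C) (m : M) : s • tmul R c m = tmul R (s • c) m :=
  map_tmul R (Module.toModuleEnd Rᵐᵒᵖ C s) LinearMap.id c m

end Tens

end Tensor

/-! ### Homomorphisms out of a bimodule -/

/-- The group `Hom_S(C, N)`; when `C` is an `(S, R)`-bimodule it is regarded as a left `R`-module
by `(r f)(c) = f(c r)`. -/
def HomS (S C N : Type u) [Ring S] [AddCommGroup C] [Module S C] [AddCommGroup N] [Module S N] :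
    Type u :=
  C →ₗ[S] N

/-- Right multiplication `c ↦ c r` on an `(S, R)`-bimodule, as an `S`-linear map. -/
def rightMul {R : Type u} (S C : Type u) [Ring R] [Ring S] [AddCommGroup C] [Module S C]
    [Module Rᵐᵒᵖ C] [SMulCommClass S Rᵐᵒᵖ C] (r : R) : C →ₗ[S] C where
  toFun c := op r • c
  map_add' := smul_add (op r)
  map_smul' s c := (smul_comm s (op r) c).symm

namespace HomS

variable {R S C : Type u} [Ring R] [Ring S] [AddCommGroup C] [Module S C] [Module Rᵐᵒᵖ C]
  [SMulCommClass S Rᵐᵒᵖ C] {N N' : Type u} [AddCommGroup N] [Module S N]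
  [AddCommGroup N'] [Module S N']

instance : AddCommGroup (HomS S C N) := inferInstanceAs (AddCommGroup (C →ₗ[S] N))

instance : FunLike (HomS S C N) C N := inferInstanceAs (FunLike (C →ₗ[S] N) C N)

instance : LinearMapClass (HomS S C N) S C N :=
  inferInstanceAs (LinearMapClass (C →ₗ[S] N) S C N)

@[ext]
lemma ext {f g : HomS S C N} (h : ∀ c, f c = g c) : f = g := LinearMap.ext h

@[simp]
lemma add_apply (f g : HomS S C N) (c : C) : (f + g) c = f c + g c := rfl

@[simp]
lemma zero_apply (c : C) : (0 : HomS S C N) c = 0 := rfl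

instance : Module R (HomS S C N) where
  smul r f := LinearMap.comp (f : C →ₗ[S] N) (rightMul S C r)
  one_smul f := by
    ext c
    change f ((op (1 : R)) • c) = f c
    simp
  mul_smul r r' f := by
    ext c
    change f (op (r * r') • c) = f (op r' • op r • c)
    rw [op_mul, mul_smul]
  smul_zero r := rfl
  smul_add r f g := rfl
  add_smul r r' f := by
    ext c
    change f (op (r + r') • c) = f (op r • c) + f (op r' • c)
    rw [MulOpposite.op_add, add_smul, map_add]
  zero_smul f := by
    ext c
    change f (op (0 : R) • c) = 0
    simp

@[simp]
lemma smul_apply (r : R) (f : HomS S C N) (c : C) : (r • f) c = f (op r • c) := rfl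

end HomS

/-! ### The two functors and the evaluation maps -/

section Functors

variable (R S C : Type u) [Ring R] [Ring S] [AddCommGroup C] [Module S C] [Module Rᵐᵒᵖ C]
  [SMulCommClass S Rᵐᵒᵖ C]

/-- `C ⊗_R g` as an `S`-linear map. -/
def tensorMap {M M' : Type u} [AddCommGroup M] [Module R M] [AddCommGroup M'] [Module R M']
    (g : M →ₗ[R] M') : Tens R C M →ₗ[S] Tens R C M' where
  toFun := Tens.map R LinearMap.id g
  map_add' := map_add _
  map_smul' s t := by
    change Tens.map R LinearMap.id g (s • t) = s • Tens.map R LinearMap.id g t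
    induction t using Tens.induction_on with
    | tmul c m => simp [Tens.smul_def]
    | add x y hx hy => rw [smul_add, map_add, map_add, smul_add, hx, hy]

/-- The functor `C ⊗_R - : R-Mod ⥤ S-Mod`. -/
def tensorFunctor : ModuleCat.{u} R ⥤ ModuleCat.{u} S where
  obj M := ModuleCat.of S (Tens R C M)
  map g := ModuleCat.ofHom (tensorMap R S C g.hom)
  map_id M := by
    ext t
    exact DFunLike.congr_fun (Tens.map_id R) t
  map_comp g g' := by
    ext t
    exact DFunLike.congr_fun (Tens.map_comp R LinearMap.id g.hom LinearMap.id g'.hom) t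

/-- `Hom_S(C, h)` as an `R`-linear map. -/
def homMap {N N' : Type u} [AddCommGroup N] [Module S N] [AddCommGroup N'] [Module S N']
    (h : N →ₗ[S] N') : HomS S C N →ₗ[R] HomS S C N' where
  toFun f := LinearMap.comp h (f : C →ₗ[S] N)
  map_add' f g := LinearMap.comp_add (f : C →ₗ[S] N) (g : C →ₗ[S] N) h
  map_smul' _ _ := rfl

/-- The functor `Hom_S(C, -) : S-Mod ⥤ R-Mod`. -/
def homFunctor : ModuleCat.{u} S ⥤ ModuleCat.{u} R where
  obj N := ModuleCat.of R (HomS S C N)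
  map h := ModuleCat.ofHom (homMap R S C h.hom)
  map_id _ := rfl
  map_comp _ _ := rfl

/-- The natural map `μ_M : M → Hom_S(C, C ⊗_R M)`, `m ↦ (c ↦ c ⊗ m)`. -/
def mu (M : Type u) [AddCommGroup M] [Module R M] : M →ₗ[R] HomS S C (Tens R C M) where
  toFun m :=
    ({ toFun := fun c => Tens.tmul R c m
       map_add' := fun c c' => Tens.add_tmul R c c' m
       map_smul' := fun s c => (Tens.smul_def R s c m).symm } : C →ₗ[S] Tens R C M)
  map_add' m m' := HomS.ext fun c => Tens.tmul_add R c m m'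
  map_smul' r m := HomS.ext fun c => (Tens.smul_tmul R c r m).symm

@[simp]
lemma mu_apply (M : Type u) [AddCommGroup M] [Module R M] (m : M) (c : C) :
    mu R S C M m c = Tens.tmul R c m := rfl

/-- The natural map `ν_N : C ⊗_R Hom_S(C, N) → N`, `c ⊗ f ↦ f(c)`. -/
def nu (N : Type u) [AddCommGroup N] [Module S N] : Tens R C (HomS S C N) →ₗ[S] N where
  toFun := Tens.lift R
    (AddMonoidHom.mk' (fun c => AddMonoidHom.mk' (fun f : HomS S C N => f c)
        (fun f g => HomS.add_apply f g c))
      (fun c c' => by ext f; exact map_add f c c'))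
    (fun c r f => (HomS.smul_apply r f c).symm)
  map_add' := map_add _
  map_smul' s t := by
    induction t using Tens.induction_on with
    | tmul c f =>
      rw [Tens.smul_def]
      exact map_smul f s c
    | add x y hx hy => rw [smul_add, map_add, map_add, smul_add, hx, hy]

@[simp]
lemma nu_tmul (N : Type u) [AddCommGroup N] [Module S N] (c : C) (f : HomS S C N) :
    nu R S C N (Tens.tmul R c f) = f c := rfl

end Functors

/-! ### Tor -/

section Tor

variable (R : Type u) [Ring R]

/-- The functor `- ⊗_R M` from right `R`-modules to abelian groups. -/
def tensorRight (M : Type u) [AddCommGroup M] [Module R M] :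
    ModuleCat.{u} Rᵐᵒᵖ ⥤ AddCommGrpCat.{u} where
  obj K := AddCommGrpCat.of (Tens R K M)
  map f := AddCommGrpCat.ofHom (Tens.map R f.hom LinearMap.id)
  map_id K := by
    ext t
    exact DFunLike.congr_fun (Tens.map_id R) t
  map_comp f f' := by
    ext t
    exact DFunLike.congr_fun (Tens.map_comp R f.hom LinearMap.id f'.hom LinearMap.id) t

instance (M : Type u) [AddCommGroup M] [Module R M] : (tensorRight R M).Additive where
  map_add {K L f g} := by
    apply AddCommGrpCat.hom_ext
    refine Tens.hom_ext (f := Tens.map R (f + g).hom (LinearMap.id : M →ₗ[R] M))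
      (g := Tens.map R f.hom (LinearMap.id : M →ₗ[R] M) +
        Tens.map R g.hom (LinearMap.id : M →ₗ[R] M)) ?_
    intro c m
    simp [Tens.add_tmul]

/-- `Tor_i^R(K, M)`, the `i`-th left derived functor of `- ⊗_R M` at `K`. -/
def Tor (K M : Type u) [AddCommGroup K] [Module Rᵐᵒᵖ K] [AddCommGroup M] [Module R M] (i : ℕ) :
    AddCommGrpCat.{u} :=
  ((tensorRight R M).leftDerived i).obj (ModuleCat.of Rᵐᵒᵖ K)

end Tor

/-! ### Finitely `n`-presented, `fp_n`-injective and `fp_n`-flat modules -/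

section FP

variable (R : Type u) [Ring R]

/-- There is an exact sequence `R^{r n} → ⋯ → R^{r 1} → R^{r 0} → M → 0`. The values `r i`, `i > n`,
and `d i`, `i ≥ n`, are irrelevant. -/
def FinitelyNPresented (n : ℕ) (M : Type u) [AddCommGroup M] [Module R M] : Prop :=
  ∃ (r : ℕ → ℕ) (ε : (Fin (r 0) → R) →ₗ[R] M)
    (d : ∀ i, (Fin (r (i + 1)) → R) →ₗ[R] (Fin (r i) → R)),
    Function.Surjective ε ∧ (1 ≤ n → Function.Exact (d 0) ε) ∧
      ∀ i, i + 2 ≤ n → Function.Exact (d (i + 1)) (d i)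

/-- The class `fp_nI(R)` of `fp_n`-injective left `R`-modules. -/
def fpI (n : ℕ) : ObjectProperty (ModuleCat.{u} R) := fun M =>
  ∀ (K L : ModuleCat.{u} R), FinitelyNPresented R n K → FinitelyNPresented R n L →
    ∀ j : K →ₗ[R] L, Function.Injective j → ∀ f : K →ₗ[R] M, ∃ g : L →ₗ[R] M, g ∘ₗ j = f

/-- The class `fp_nF(R)` of `fp_n`-flat left `R`-modules. -/
def fpF (n : ℕ) : ObjectProperty (ModuleCat.{u} R) := fun M =>
  ∀ (K L : ModuleCat.{u} Rᵐᵒᵖ), FinitelyNPresented Rᵐᵒᵖ n K → FinitelyNPresented Rᵐᵒᵖ n L →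
    ∀ j : K →ₗ[Rᵐᵒᵖ] L, Function.Injective j →
      Function.Injective (Tens.map R j (LinearMap.id : M →ₗ[R] M))

variable {R}

/-- There is an exact sequence `0 → M → I 0 → I 1 → ⋯ → I k → 0` with all `I i` in the class
`P`. It is encoded with `I (k + 1) = 0`; what comes after that is irrelevant. -/
def coresolDimLE (P : ObjectProperty (ModuleCat.{u} R)) (k : ℕ) :
    ObjectProperty (ModuleCat.{u} R) := fun M =>
  ∃ (I : ℕ → ModuleCat.{u} R) (ε : M →ₗ[R] I 0) (d : ∀ i, I i →ₗ[R] I (i + 1)),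
    (∀ i ≤ k, P (I i)) ∧ Subsingleton (I (k + 1)) ∧
    Function.Injective ε ∧ Function.Exact ε (d 0) ∧ ∀ i < k, Function.Exact (d i) (d (i + 1))

/-- There is an exact sequence `0 → F k → ⋯ → F 1 → F 0 → M → 0` with all `F i` in the class
`P`. It is encoded with `F (k + 1) = 0`; what comes after that is irrelevant. -/
def resolDimLE (P : ObjectProperty (ModuleCat.{u} R)) (k : ℕ) :
    ObjectProperty (ModuleCat.{u} R) := fun M =>
  ∃ (F : ℕ → ModuleCat.{u} R) (ε : F 0 →ₗ[R] M) (d : ∀ i, F (i + 1) →ₗ[R] F i),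
    (∀ i ≤ k, P (F i)) ∧ Subsingleton (F (k + 1)) ∧
    Function.Surjective ε ∧ Function.Exact (d 0) ε ∧ ∀ i < k, Function.Exact (d (i + 1)) (d i)

variable (R)

/-- The class `fp_nI(R)_{≤k}`. -/
def fpILE (n k : ℕ) : ObjectProperty (ModuleCat.{u} R) := coresolDimLE (fpI R n) k

/-- The class `fp_nF(R)_{≤k}`. -/
def fpFLE (n k : ℕ) : ObjectProperty (ModuleCat.{u} R) := resolDimLE (fpF R n) k

end FP

/-! ### Semidualizing bimodules and the associated classes -/

section Classes

variable (R S C : Type u) [Ring R] [Ring S] [AddCommGroup C] [Module S C] [Module Rᵐᵒᵖ C]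
  [SMulCommClass S Rᵐᵒᵖ C]

/-- `M` has a resolution by finitely generated projective modules. -/
def HasDegreewiseFiniteResolution (A M : Type u) [Ring A] [AddCommGroup M] [Module A M] : Prop :=
  ∃ P : ProjectiveResolution (ModuleCat.of A M), ∀ i, Module.Finite A (P.complex.X i)

/-- `Ext^i_A(M, N) = 0` for all `i ≥ 1`. -/
def ExtVanishes (A M N : Type u) [Ring A] [AddCommGroup M] [Module A M] [AddCommGroup N]
    [Module A N] : Prop :=
  ∀ i : ℕ, 1 ≤ i → Subsingleton (Abelian.Ext (ModuleCat.of A M) (ModuleCat.of A N) i)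

/-- `Tor_i^R(K, M) = 0` for all `i ≥ 1`. -/
def TorVanishes (K M : Type u) [AddCommGroup K] [Module Rᵐᵒᵖ K] [AddCommGroup M]
    [Module R M] : Prop :=
  ∀ i : ℕ, 1 ≤ i → Subsingleton (Tor R K M i)

/-- The `(S, R)`-bimodule `C` is semidualizing. -/
structure IsSemidualizing : Prop where
  finite_left : HasDegreewiseFiniteResolution S C
  finite_right : HasDegreewiseFiniteResolution Rᵐᵒᵖ C
  /-- `S → Hom_{R^op}(C, C)`, `s ↦ (c ↦ s c)`. -/
  homothety_left : Function.Bijective fun s : S => Module.toModuleEnd Rᵐᵒᵖ C s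
  /-- `R → Hom_S(C, C)`, `r ↦ (c ↦ c r)`. -/
  homothety_right : Function.Bijective fun r : R => rightMul S C r
  ext_left : ExtVanishes S C C
  ext_right : ExtVanishes Rᵐᵒᵖ C C

/-- The `(S, R)`-bimodule `C` is faithfully semidualizing. -/
structure IsFaithfullySemidualizing : Prop extends IsSemidualizing R S C where
  faithful_left : ∀ N : ModuleCat.{u} S, Subsingleton (C →ₗ[S] N) → Subsingleton N
  faithful_right : ∀ M : ModuleCat.{u} Rᵐᵒᵖ, Subsingleton (C →ₗ[Rᵐᵒᵖ] M) → Subsingleton M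

/-- The Auslander class `A_C(R)`. -/
def auslander : ObjectProperty (ModuleCat.{u} R) := fun M =>
  TorVanishes R C M ∧ ExtVanishes S C (Tens R C M) ∧ Function.Bijective (mu R S C M)

/-- The Bass class `B_C(S)`. -/
def bass : ObjectProperty (ModuleCat.{u} S) := fun N =>
  ExtVanishes S C N ∧ TorVanishes R C (HomS S C N) ∧ Function.Bijective (nu R S C N)

/-- The class `Cfp_nI(R)` of modules isomorphic to `Hom_S(C, X)` with `X` in `fp_nI(S)`. -/
def CfpI (n : ℕ) : ObjectProperty (ModuleCat.{u} R) := fun M =>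
  ∃ X : ModuleCat.{u} S, fpI S n X ∧ Nonempty (M ≅ (homFunctor R S C).obj X)

/-- The class `Cfp_nF(S)` of modules isomorphic to `C ⊗_R Y` with `Y` in `fp_nF(R)`. -/
def CfpF (n : ℕ) : ObjectProperty (ModuleCat.{u} S) := fun N =>
  ∃ Y : ModuleCat.{u} R, fpF R n Y ∧ Nonempty (N ≅ (tensorFunctor R S C).obj Y)

/-- The class `Cfp_nI(R)_{≤k}`. -/
def CfpILE (n k : ℕ) : ObjectProperty (ModuleCat.{u} R) := coresolDimLE (CfpI R S C n) k

/-- The class `Cfp_nF(S)_{≤k}`. -/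
def CfpFLE (n k : ℕ) : ObjectProperty (ModuleCat.{u} S) := resolDimLE (CfpF R S C n) k

end Classes

/-! ### Equivalences induced by `C ⊗_R -` and `Hom_S(C, -)` -/

section Equivalences

variable (R S C : Type u) [Ring R] [Ring S] [AddCommGroup C] [Module S C] [Module Rᵐᵒᵖ C]
  [SMulCommClass S Rᵐᵒᵖ C]

/-- The restriction of `C ⊗_R -` to full subcategories. -/
def tensorRestrict (P : ObjectProperty (ModuleCat.{u} R)) (Q : ObjectProperty (ModuleCat.{u} S))
    (h : ∀ M, P M → Q ((tensorFunctor R S C).obj M)) : P.FullSubcategory ⥤ Q.FullSubcategory :=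
  Q.lift (P.ι ⋙ tensorFunctor R S C) fun M => h M.obj M.property

/-- The restriction of `Hom_S(C, -)` to full subcategories. -/
def homRestrict (P : ObjectProperty (ModuleCat.{u} R)) (Q : ObjectProperty (ModuleCat.{u} S))
    (h : ∀ N, Q N → P ((homFunctor R S C).obj N)) : Q.FullSubcategory ⥤ P.FullSubcategory :=
  P.lift (Q.ι ⋙ homFunctor R S C) fun N => h N.obj N.property

/-- The functors `C ⊗_R -` and `Hom_S(C, -)` map the classes `P` and `Q` to each other, and the
natural maps `μ` and `ν` make their restrictions mutually quasi-inverse. -/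
structure InducedEquivalence (P : ObjectProperty (ModuleCat.{u} R))
    (Q : ObjectProperty (ModuleCat.{u} S)) where
  tensor_mem : ∀ M, P M → Q ((tensorFunctor R S C).obj M)
  hom_mem : ∀ N, Q N → P ((homFunctor R S C).obj N)
  unitIso : 𝟭 P.FullSubcategory ≅
    tensorRestrict R S C P Q tensor_mem ⋙ homRestrict R S C P Q hom_mem
  counitIso : homRestrict R S C P Q hom_mem ⋙ tensorRestrict R S C P Q tensor_mem ≅
    𝟭 Q.FullSubcategory
  unit_app : ∀ M : P.FullSubcategory,
    (unitIso.hom.app M).hom = ModuleCat.ofHom (mu R S C M.obj)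
  counit_app : ∀ N : Q.FullSubcategory,
    (counitIso.hom.app N).hom = ModuleCat.ofHom (nu R S C N.obj)

variable {R S C} {P P' : ObjectProperty (ModuleCat.{u} R)} {Q Q' : ObjectProperty (ModuleCat.{u} S)}

/-- The equivalence of categories with functor `C ⊗_R -` and inverse `Hom_S(C, -)`. -/
def InducedEquivalence.equivalence (E : InducedEquivalence R S C P Q) :
    P.FullSubcategory ≌ Q.FullSubcategory where
  functor := tensorRestrict R S C P Q E.tensor_mem
  inverse := homRestrict R S C P Q E.hom_mem
  unitIso := E.unitIso
  counitIso := E.counitIso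
  functor_unitIso_comp M := by
    apply ObjectProperty.hom_ext
    rw [ObjectProperty.FullSubcategory.comp_hom, E.counit_app]
    change (tensorFunctor R S C).map (E.unitIso.hom.app M).hom ≫ _ = 𝟙 _
    rw [E.unit_app]
    ext t
    change nu R S C (Tens R C M.obj) (Tens.map R LinearMap.id (mu R S C M.obj) t) = t
    induction t using Tens.induction_on with
    | tmul c m =>
      rw [Tens.map_tmul, nu_tmul]
      rfl
    | add x y hx hy => rw [map_add, map_add, hx, hy]

/-- `P ⊆ P'`, `Q ⊆ Q'`, and the inclusions of full subcategories commute with the equivalences. -/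
def Compatible (E : InducedEquivalence R S C P Q) (E' : InducedEquivalence R S C P' Q') : Prop :=
  ∃ (hP : P ≤ P') (hQ : Q ≤ Q'),
    ObjectProperty.ιOfLE hP ⋙ E'.equivalence.functor =
      E.equivalence.functor ⋙ ObjectProperty.ιOfLE hQ ∧
    ObjectProperty.ιOfLE hQ ⋙ E'.equivalence.inverse =
      E.equivalence.inverse ⋙ ObjectProperty.ιOfLE hP

end Equivalences

end

end Foxby

namespace Foxby

noncomputable section

/-! ### Right exactness of the tensor product -/

namespace Tens

variable {R : Type u} [Ring R] {C C' C'' : Type u}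
  [AddCommGroup C] [Module Rᵐᵒᵖ C] [AddCommGroup C'] [Module Rᵐᵒᵖ C']
  [AddCommGroup C''] [Module Rᵐᵒᵖ C'']
  {M M' M'' : Type u} [AddCommGroup M] [Module R M] [AddCommGroup M'] [Module R M']
  [AddCommGroup M''] [Module R M'']

/-! On the Auslander and Bass classes `μ` and `ν` are bijective by definition, and the triangle
identities show that the two functors exchange these classes. Hence any subclasses of `auslander`
and `bass` that the functors map into each other are equivalent (`InducedEquivalence.ofLE`), and all
squares of inclusions commute because the functors are restrictions of the same ambient ones. Two
things remain.

(1) `fpF_le_auslander` and `fpI_le_bass`. Take a resolution of `C` over `S` by finitely generated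
free modules, with syzygies `K_m`. As `Ext_S(C, C) = 0`, applying `Hom_S(-, C)` gives short exact
sequences `0 → Hom(K_m, C) → C^r → Hom(K_{m+1}, C) → 0` of right `R`-modules, starting from
`Hom_S(C, C) ≅ R`. By induction every `Hom(K_m, C)` has a resolution by finitely generated free
modules, so it is finitely `n`-presented for every `n`, and an `fp_n`-flat `Y` keeps the
monomorphisms `Hom(K_m, C) → C^r` injective after `- ⊗_R Y`. Comparison with the free case makes
tensor evaluation `Hom_S(K_m, C) ⊗_R Y → Hom_S(K_m, C ⊗_R Y)` bijective. For `K_0 ≅ C` this is `μ_Y`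
up to isomorphism, and for the higher syzygies it yields `Ext_S(C, C ⊗_R Y) = 0`. The vanishing of
Tor follows from flatness tested on the syzygies of `C` over `R^op`. The injective case is dual,
with Hom evaluation instead.

(2) The classes with index `≤ k` are reached by induction on `k` along short exact sequences, using
that `auslander` and `bass` are closed under cokernels of monomorphisms and kernels of epimorphisms
and that the functors keep these sequences exact (`auslander_cokernel`, `auslander_kernel`,
`bass_cokernel`, `bass_kernel`). Faithfulness enters in the first and the last: it forces the kernel
of `C ⊗ f`, respectively the cokernel of `Hom(C, g)`, to vanish. -/

lemma tmul_zero (c : C) : tmul R c (0 : M) = 0 := by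
  have h := tmul_add R c (0 : M) 0
  rw [add_zero] at h
  simpa using h

lemma zero_tmul (m : M) : tmul R (0 : C) m = 0 := by
  have h := add_tmul R (0 : C) 0 m
  rw [add_zero] at h
  simpa using h

lemma tmul_sub (c : C) (m m' : M) : tmul R c (m - m') = tmul R c m - tmul R c m' := by
  rw [eq_sub_iff_add_eq, ← tmul_add, sub_add_cancel]

lemma sub_tmul (c c' : C) (m : M) : tmul R (c - c') m = tmul R c m - tmul R c' m := by
  rw [eq_sub_iff_add_eq, ← add_tmul, sub_add_cancel]

lemma map_map (f : C →ₗ[Rᵐᵒᵖ] C') (g : M →ₗ[R] M') (f' : C' →ₗ[Rᵐᵒᵖ] C'')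
    (g' : M' →ₗ[R] M'') (t : Tens R C M) :
    map R f' g' (map R f g t) = map R (f' ∘ₗ f) (g' ∘ₗ g) t :=
  (DFunLike.congr_fun (map_comp R f g f' g') t).symm

lemma map_map_left (f : C →ₗ[Rᵐᵒᵖ] C') (f' : C' →ₗ[Rᵐᵒᵖ] C'') (t : Tens R C M) :
    map R f' (LinearMap.id : M →ₗ[R] M) (map R f LinearMap.id t) =
      map R (f' ∘ₗ f) LinearMap.id t := by
  rw [map_map, LinearMap.id_comp]

lemma map_comm (f : C →ₗ[Rᵐᵒᵖ] C') (g : M →ₗ[R] M') (t : Tens R C M) :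
    map R f LinearMap.id (map R LinearMap.id g t) =
      map R LinearMap.id g (map R f LinearMap.id t) := by
  rw [map_map, map_map, LinearMap.id_comp, LinearMap.id_comp, LinearMap.comp_id,
    LinearMap.comp_id]

lemma map_id_apply (t : Tens R C M) :
    map R (LinearMap.id : C →ₗ[Rᵐᵒᵖ] C) (LinearMap.id : M →ₗ[R] M) t = t :=
  DFunLike.congr_fun (map_id R) t

lemma map_surjective {f : C →ₗ[Rᵐᵒᵖ] C'} {g : M →ₗ[R] M'} (hf : Function.Surjective f)
    (hg : Function.Surjective g) : Function.Surjective (map R f g) := by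
  intro t
  induction t using Tens.induction_on with
  | tmul c m =>
    obtain ⟨c, rfl⟩ := hf c
    obtain ⟨m, rfl⟩ := hg m
    exact ⟨tmul R c m, map_tmul R f g c m⟩
  | add x y hx hy =>
    obtain ⟨x, rfl⟩ := hx
    obtain ⟨y, rfl⟩ := hy
    exact ⟨x + y, map_add _ _ _⟩

/-- `f ⊗ g` for isomorphisms `f` and `g`. -/
lemma map_bijective (e : C ≃ₗ[Rᵐᵒᵖ] C') (e' : M ≃ₗ[R] M') :
    Function.Bijective (map R e.toLinearMap e'.toLinearMap) := by
  refine Function.bijective_iff_has_inverse.2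
    ⟨map R e.symm.toLinearMap e'.symm.toLinearMap, fun t => ?_, fun t => ?_⟩
  · rw [map_map, e.symm_comp, e'.symm_comp, map_id_apply]
  · rw [map_map, e.comp_symm, e'.comp_symm, map_id_apply]

lemma map_add_left (f f' : C →ₗ[Rᵐᵒᵖ] C') (g : M →ₗ[R] M') (t : Tens R C M) :
    map R (f + f') g t = map R f g t + map R f' g t :=
  DFunLike.congr_fun (hom_ext (f := map R (f + f') g) (g := map R f g + map R f' g)
    (fun c m => by simp [add_tmul])) t

lemma map_zero_left (g : M →ₗ[R] M') (t : Tens R C M) :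
    map R (0 : C →ₗ[Rᵐᵒᵖ] C') g t = 0 :=
  DFunLike.congr_fun (hom_ext (f := map R (0 : C →ₗ[Rᵐᵒᵖ] C') g) (g := 0)
    (fun c m => by simp [zero_tmul])) t

lemma map_zero_right (f : C →ₗ[Rᵐᵒᵖ] C') (t : Tens R C M) :
    map R f (0 : M →ₗ[R] M') t = 0 :=
  DFunLike.congr_fun (hom_ext (f := map R f (0 : M →ₗ[R] M')) (g := 0)
    (fun c m => by simp [tmul_zero])) t

lemma map_sum_left {ι : Type*} (s : Finset ι) (f : ι → C →ₗ[Rᵐᵒᵖ] C') (g : M →ₗ[R] M')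
    (t : Tens R C M) : map R (∑ i ∈ s, f i) g t = ∑ i ∈ s, map R (f i) g t := by
  classical
  induction s using Finset.induction_on with
  | empty => simp [map_zero_left]
  | insert a s ha ih => rw [Finset.sum_insert ha, Finset.sum_insert ha, map_add_left, ih]

/-- Sending `c ⊗ m` to the class of `c ⊗ s m`, with `s` a set-theoretic section of `g`, is well
defined modulo the image of `C ⊗ f` although `s` is not additive (`key`). Composed with `C ⊗ g` it
is the quotient map, so the kernel of `C ⊗ g` lies in that image. -/
lemma exact_map_right {f : M →ₗ[R] M'} {g : M' →ₗ[R] M''} (hfg : Function.Exact f g)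
    (hg : Function.Surjective g) :
    Function.Exact (map R (LinearMap.id : C →ₗ[Rᵐᵒᵖ] C) f)
      (map R (LinearMap.id : C →ₗ[Rᵐᵒᵖ] C) g) := by
  let F := map R (LinearMap.id : C →ₗ[Rᵐᵒᵖ] C) f
  let G := map R (LinearMap.id : C →ₗ[Rᵐᵒᵖ] C) g
  let q := QuotientAddGroup.mk' F.range
  have key : ∀ (c : C) (m m' : M'), g m = g m' → q (tmul R c m) = q (tmul R c m') := by
    intro c m m' h
    obtain ⟨a, ha⟩ := (hfg (m - m')).1 (by rw [map_sub, h, sub_self])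
    rw [← sub_eq_zero, ← map_sub, ← tmul_sub, ← ha]
    refine (QuotientAddGroup.eq_zero_iff _).2 ⟨tmul R c a, ?_⟩
    exact map_tmul R _ _ c a
  let s := Function.surjInv hg
  have hs : ∀ m, g (s m) = m := Function.surjInv_eq hg
  let φ : Tens R C M'' →+ Tens R C M' ⧸ F.range :=
    lift R (AddMonoidHom.mk' (fun c => AddMonoidHom.mk' (fun m => q (tmul R c (s m)))
        (fun m m' => by rw [← map_add, ← tmul_add]; exact key _ _ _ (by simp [hs])))
      (fun c c' => by ext m; simp [add_tmul]))
      (fun c r m => by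
        change q (tmul R (op r • c) (s m)) = q (tmul R c (s (r • m)))
        rw [smul_tmul]; exact key _ _ _ (by simp [hs]))
  have hφ : ∀ t, φ (G t) = q t := fun t => DFunLike.congr_fun
    (hom_ext (f := φ.comp G) (g := q) (fun c m => by
      change φ (map R _ g (tmul R c m)) = _
      rw [map_tmul]
      exact key _ _ _ (hs _))) t
  intro t
  constructor
  · intro ht
    have : q t = 0 := by rw [← hφ, show G t = 0 from ht, map_zero]
    exact (QuotientAddGroup.eq_zero_iff _).1 this
  · rintro ⟨a, rfl⟩
    rw [map_map, hfg.linearMap_comp_eq_zero, map_zero_right]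

lemma exact_map_left {f : C →ₗ[Rᵐᵒᵖ] C'} {g : C' →ₗ[Rᵐᵒᵖ] C''} (hfg : Function.Exact f g)
    (hg : Function.Surjective g) :
    Function.Exact (map R f (LinearMap.id : M →ₗ[R] M))
      (map R g (LinearMap.id : M →ₗ[R] M)) := by
  let F := map R f (LinearMap.id : M →ₗ[R] M)
  let G := map R g (LinearMap.id : M →ₗ[R] M)
  let q := QuotientAddGroup.mk' F.range
  have key : ∀ (m : M) (c c' : C'), g c = g c' → q (tmul R c m) = q (tmul R c' m) := by
    intro m c c' h
    obtain ⟨a, ha⟩ := (hfg (c - c')).1 (by rw [map_sub, h, sub_self])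
    rw [← sub_eq_zero, ← map_sub, ← sub_tmul, ← ha]
    refine (QuotientAddGroup.eq_zero_iff _).2 ⟨tmul R a m, ?_⟩
    exact map_tmul R _ _ a m
  let s := Function.surjInv hg
  have hs : ∀ m, g (s m) = m := Function.surjInv_eq hg
  let φ : Tens R C'' M →+ Tens R C' M ⧸ F.range :=
    lift R (AddMonoidHom.mk' (fun c => AddMonoidHom.mk' (fun m => q (tmul R (s c) m))
        (fun m m' => by rw [← map_add, ← tmul_add]))
      (fun c c' => by
        ext m
        change q (tmul R (s (c + c')) m) = q (tmul R (s c) m) + q (tmul R (s c') m)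
        rw [← map_add, ← add_tmul]; exact key _ _ _ (by simp [hs])))
      (fun c r m => by
        change q (tmul R (s (op r • c)) m) = q (tmul R (s c) (r • m))
        rw [← smul_tmul]; exact key _ _ _ (by simp [hs]))
  have hφ : ∀ t, φ (G t) = q t := fun t => DFunLike.congr_fun
    (hom_ext (f := φ.comp G) (g := q) (fun c m => by
      change φ (map R g _ (tmul R c m)) = _
      rw [map_tmul]
      exact key _ _ _ (hs _))) t
  intro t
  constructor
  · intro ht
    have : q t = 0 := by rw [← hφ, show G t = 0 from ht, map_zero]
    exact (QuotientAddGroup.eq_zero_iff _).1 this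
  · rintro ⟨a, rfl⟩
    rw [map_map, hfg.linearMap_comp_eq_zero, map_zero_left]

/-! ### Tensor products with finitely generated free right modules -/

/-- The `j`-th coordinate of an element of `R^n ⊗_R M`. -/
def coord (M : Type u) [AddCommGroup M] [Module R M] {n : ℕ} (j : Fin n) :
    Tens R (Fin n → Rᵐᵒᵖ) M →+ M :=
  lift R (AddMonoidHom.mk' (fun c => AddMonoidHom.mk' (fun m => unop (c j) • m)
      (fun m m' => smul_add _ m m'))
    (fun c c' => by ext m; simp [add_smul]))
    (fun c r m => by simp [mul_smul])

lemma coord_tmul {n : ℕ} (j : Fin n) (c : Fin n → Rᵐᵒᵖ) (m : M) :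
    coord M j (tmul R c m) = unop (c j) • m := rfl

lemma coord_map {n : ℕ} (j : Fin n) (g : M →ₗ[R] M') (t : Tens R (Fin n → Rᵐᵒᵖ) M) :
    coord M' j (map R LinearMap.id g t) = g (coord M j t) :=
  DFunLike.congr_fun (hom_ext (f := (coord M' j).comp (map R LinearMap.id g))
    (g := g.toAddMonoidHom.comp (coord M j)) (fun c m => by simp [coord_tmul])) t

lemma sum_tmul {ι : Type*} (s : Finset ι) (c : ι → C) (m : M) :
    tmul R (∑ i ∈ s, c i) m = ∑ i ∈ s, tmul R (c i) m :=
  map_sum (AddMonoidHom.mk' (fun c => tmul R c m) (fun c c' => add_tmul R c c' m)) c s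

lemma sum_single_coord {n : ℕ} (t : Tens R (Fin n → Rᵐᵒᵖ) M) :
    ∑ j, tmul R (Pi.single j (1 : Rᵐᵒᵖ)) (coord M j t) = t := by
  induction t using Tens.induction_on with
  | tmul c m =>
    simp_rw [coord_tmul, ← smul_tmul, op_unop]
    rw [← sum_tmul]
    congr 1
    ext k
    simp [Finset.sum_apply, Pi.single_apply]
  | add x y hx hy =>
    simp_rw [map_add, tmul_add, Finset.sum_add_distrib, hx, hy]

/-- Finitely generated free modules are flat: coordinates determine a tensor and commute with `g`.
-/
lemma map_injective_of_free {n : ℕ} {g : M →ₗ[R] M'} (hg : Function.Injective g) :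
    Function.Injective (map R (LinearMap.id : (Fin n → Rᵐᵒᵖ) →ₗ[Rᵐᵒᵖ] _) g) := by
  refine (injective_iff_map_eq_zero _).2 fun t ht => ?_
  rw [← sum_single_coord t]
  refine Finset.sum_eq_zero fun j _ => ?_
  have : coord M j t = 0 := hg (by rw [← coord_map, ht, map_zero, map_zero])
  rw [this, tmul_zero]

end Tens

end

noncomputable section

/-! ### Modules with a resolution by finitely generated free modules -/

section FreeResolutions

variable {A : Type u} [Ring A]

lemma exists_lift_of_exact {K F N X : Type*} [AddCommGroup K] [Module A K] [AddCommGroup F]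
    [Module A F] [AddCommGroup N] [Module A N] [AddCommGroup X] [Module A X]
    {i : K →ₗ[A] F} {p : F →ₗ[A] N} (hi : Function.Injective i) (he : Function.Exact i p)
    (f : X →ₗ[A] F) (hf : p ∘ₗ f = 0) : ∃ g : X →ₗ[A] K, i ∘ₗ g = f := by
  have hr : ∀ x, f x ∈ LinearMap.range i := fun x =>
    (he (f x)).1 (LinearMap.congr_fun hf x)
  refine ⟨(LinearEquiv.ofInjective i hi).symm.toLinearMap ∘ₗ f.codRestrict _ hr, ?_⟩
  ext x
  have := LinearEquiv.apply_symm_apply (LinearEquiv.ofInjective i hi) (f.codRestrict _ hr x)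
  exact congrArg Subtype.val this

lemma exists_desc_of_exact {K F N X : Type*} [AddCommGroup K] [Module A K] [AddCommGroup F]
    [Module A F] [AddCommGroup N] [Module A N] [AddCommGroup X] [Module A X]
    {i : K →ₗ[A] F} {p : F →ₗ[A] N} (hp : Function.Surjective p) (he : Function.Exact i p)
    (f : F →ₗ[A] X) (hf : f ∘ₗ i = 0) : ∃ g : N →ₗ[A] X, g ∘ₗ p = f := by
  have hk : LinearMap.ker p ≤ LinearMap.ker f := by
    intro x hx
    obtain ⟨k, rfl⟩ := (he x).1 hx
    exact LinearMap.congr_fun hf k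
  refine ⟨(LinearMap.ker p).liftQ f hk ∘ₗ (p.quotKerEquivOfSurjective hp).symm.toLinearMap, ?_⟩
  ext x
  have : (p.quotKerEquivOfSurjective hp).symm (p x) = (LinearMap.ker p).mkQ x := by
    rw [LinearEquiv.symm_apply_eq]
    rfl
  simp [this]

variable (A) in
/-- A resolution of `M` by finitely generated free modules, together with its syzygies: short
exact sequences `0 → K (n + 1) → A ^ rk n → K n → 0` with `K 0` isomorphic to `M`. -/
structure FreeRes (M : Type u) [AddCommGroup M] [Module A M] where
  /-- The rank of the free module in degree `n`. -/
  rk : ℕ → ℕ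
  /-- The syzygies. -/
  K : ℕ → ModuleCat.{u} A
  /-- The identification of the zeroth syzygy. -/
  e : K 0 ≃ₗ[A] M
  /-- The inclusion of a syzygy. -/
  i : ∀ n, K (n + 1) →ₗ[A] (Fin (rk n) → A)
  /-- The free cover of a syzygy. -/
  p : ∀ n, (Fin (rk n) → A) →ₗ[A] K n
  injective_i : ∀ n, Function.Injective (i n)
  surjective_p : ∀ n, Function.Surjective (p n)
  exact : ∀ n, Function.Exact (i n) (p n)

variable (A) in
/-- `M` has a resolution by finitely generated free modules. -/
def FPInf (M : Type u) [AddCommGroup M] [Module A M] : Prop := Nonempty (FreeRes A M)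

variable {M N : Type u} [AddCommGroup M] [Module A M] [AddCommGroup N] [Module A N]

/-- The resolution of the `n`-th syzygy. -/
def FreeRes.shift (P : FreeRes A M) (n : ℕ) : FreeRes A (P.K n) where
  rk j := P.rk (n + j)
  K j := P.K (n + j)
  e := LinearEquiv.refl A _
  i j := P.i (n + j)
  p j := P.p (n + j)
  injective_i j := P.injective_i (n + j)
  surjective_p j := P.surjective_p (n + j)
  exact j := P.exact (n + j)

lemma FreeRes.exact_d (P : FreeRes A M) (n : ℕ) :
    Function.Exact (P.i (n + 1) ∘ₗ P.p (n + 2)) (P.i n ∘ₗ P.p (n + 1)) := by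
  intro x
  constructor
  · intro hx
    obtain ⟨k, rfl⟩ := (P.exact (n + 1) x).1 (P.injective_i n (by rw [map_zero]; exact hx))
    obtain ⟨y, rfl⟩ := P.surjective_p (n + 2) k
    exact ⟨y, rfl⟩
  · rintro ⟨y, rfl⟩
    simp only [LinearMap.comp_apply]
    rw [(P.exact (n + 1)).apply_apply_eq_zero, map_zero]

lemma FreeRes.exact_ε (P : FreeRes A M) :
    Function.Exact (P.i 0 ∘ₗ P.p 1) (P.e.toLinearMap ∘ₗ P.p 0) := by
  intro x
  constructor
  · intro hx
    obtain ⟨k, rfl⟩ := (P.exact 0 x).1 (P.e.injective (by rw [map_zero]; exact hx))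
    obtain ⟨y, rfl⟩ := P.surjective_p 1 k
    exact ⟨y, rfl⟩
  · rintro ⟨y, rfl⟩
    simp only [LinearMap.comp_apply]
    rw [(P.exact 0).apply_apply_eq_zero, map_zero]

lemma FPInf.finitelyNPresented (h : FPInf A M) (n : ℕ) : FinitelyNPresented A n M := by
  obtain ⟨P⟩ := h
  exact ⟨P.rk, P.e.toLinearMap ∘ₗ P.p 0, fun j => P.i j ∘ₗ P.p (j + 1),
    P.e.surjective.comp (P.surjective_p 0), fun _ => P.exact_ε, fun j _ => P.exact_d j⟩

lemma FPInf.of_equiv (h : FPInf A M) (e : M ≃ₗ[A] N) : FPInf A N := by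
  obtain ⟨P⟩ := h
  exact ⟨{ P with e := P.e.trans e }⟩

variable (A) in
/-- `N` has a finitely generated free cover whose kernel belongs to the class `𝒬`. -/
def HasCover (𝒬 : ObjectProperty (ModuleCat.{u} A)) (N : Type u) [AddCommGroup N] [Module A N] :
    Prop :=
  ∃ (r : ℕ) (K : ModuleCat.{u} A) (i : K →ₗ[A] (Fin r → A)) (p : (Fin r → A) →ₗ[A] N),
    Function.Injective i ∧ Function.Surjective p ∧ Function.Exact i p ∧ 𝒬 K

lemma FPInf.hasCover (h : FPInf A M) : HasCover A (fun K => FPInf A K) M := by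
  obtain ⟨P⟩ := h
  refine ⟨P.rk 0, P.K 1, P.i 0, P.e.toLinearMap ∘ₗ P.p 0, P.injective_i 0,
    P.e.surjective.comp (P.surjective_p 0), fun x => ?_, ⟨P.shift 1⟩⟩
  rw [← P.exact 0 x]
  exact P.e.map_eq_zero_iff

/-- Coinduction: a module in a class whose members have finitely generated free covers with
kernels in the class has a resolution by finitely generated free modules. -/
lemma FPInf.coinduction (𝒬 : ObjectProperty (ModuleCat.{u} A))
    (h : ∀ N : ModuleCat.{u} A, 𝒬 N → HasCover A 𝒬 N) (hM : 𝒬 (ModuleCat.of A M)) :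
    FPInf A M := by
  choose r K i p hi hp he hK using h
  -- Iterating the chosen kernel produces all syzygies, each with its proof of membership in `𝒬`.
  let seq : ℕ → {N : ModuleCat.{u} A // 𝒬 N} := fun n =>
    Nat.rec ⟨ModuleCat.of A M, hM⟩ (fun _ N => ⟨K N.1 N.2, hK N.1 N.2⟩) n
  exact ⟨{
    rk := fun n => r (seq n).1 (seq n).2
    K := fun n => (seq n).1
    e := LinearEquiv.refl A M
    i := fun n => i (seq n).1 (seq n).2
    p := fun n => p (seq n).1 (seq n).2
    injective_i := fun n => hi _ _
    surjective_p := fun n => hp _ _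
    exact := fun n => he _ _ }⟩

/-- Coinduction on the class of modules with such a cover, which contains `M`: the kernel of the
cover has a resolution, hence again a cover of this kind. -/
lemma FPInf.of_hasCover (h : HasCover A (fun K => FPInf A K) M) : FPInf A M := by
  refine FPInf.coinduction (fun N => HasCover A (fun K => FPInf A K) N) ?_ h
  rintro N ⟨r, K, i, p, hi, hp, he, hK⟩
  exact ⟨r, K, i, p, hi, hp, he, hK.hasCover⟩

lemma FPInf.of_subsingleton [Subsingleton M] : FPInf A M := by
  refine FPInf.coinduction (fun N => Subsingleton N) ?_ ‹_›
  intro N hN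
  exact ⟨0, N, 0, 0, Function.injective_of_subsingleton _,
    fun x => ⟨0, Subsingleton.elim _ _⟩, fun x => ⟨fun _ => ⟨0, Subsingleton.elim _ _⟩,
    fun _ => rfl⟩, hN⟩

lemma FPInf.pi (r : ℕ) : FPInf A (Fin r → A) := by
  refine FPInf.of_hasCover ⟨r, ModuleCat.of A PUnit, 0, LinearMap.id, ?_, fun x => ⟨x, rfl⟩, ?_, ?_⟩
  · exact Function.injective_of_subsingleton _
  · intro x
    constructor
    · rintro rfl
      exact ⟨0, rfl⟩
    · rintro ⟨y, rfl⟩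
      rfl
  · exact FPInf.of_subsingleton (M := PUnit)

lemma FPInf.self : FPInf A A := (FPInf.pi 1).of_equiv (LinearEquiv.funUnique (Fin 1) A A)

/-- The class of modules with resolutions by finitely generated free modules is closed under
extensions. -/
lemma FPInf.extension {M' M'' : Type u} [AddCommGroup M'] [Module A M'] [AddCommGroup M'']
    [Module A M''] (h' : FPInf A M') (h'' : FPInf A M'') (f : M' →ₗ[A] M) (g : M →ₗ[A] M'')
    (hf : Function.Injective f) (hg : Function.Surjective g) (hfg : Function.Exact f g) :
    FPInf A M := by
  -- The coinductive class consists of all extensions of two modules with resolutions. By the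
  -- horseshoe lemma the sum of the two covers covers the extension, and its kernel is an extension
  -- of `K₂` by `K₁`.
  refine FPInf.coinduction (fun N => ∃ (X Y : ModuleCat.{u} A) (f : X →ₗ[A] N) (g : N →ₗ[A] Y),
    FPInf A X ∧ FPInf A Y ∧ Function.Injective f ∧ Function.Surjective g ∧ Function.Exact f g) ?_
    ⟨ModuleCat.of A M', ModuleCat.of A M'', f, g, h', h'', hf, hg, hfg⟩
  clear hfg hg hf g f h' h''
  rintro N ⟨X, Y, f, g, hX, hY, hf, hg, hfg⟩
  obtain ⟨r₁, K₁, i₁, p₁, hi₁, hp₁, he₁, hK₁⟩ := hX.hasCover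
  obtain ⟨r₂, K₂, i₂, p₂, hi₂, hp₂, he₂, hK₂⟩ := hY.hasCover
  obtain ⟨l, hl⟩ := Module.projective_lifting_property g p₂ hg
  let e : (Fin (r₁ + r₂) → A) ≃ₗ[A] (Fin r₁ → A) × (Fin r₂ → A) :=
    (LinearEquiv.funCongrLeft A A finSumFinEquiv).trans
      (LinearEquiv.sumArrowLequivProdArrow (Fin r₁) (Fin r₂) A A)
  let p : (Fin (r₁ + r₂) → A) →ₗ[A] N := (LinearMap.coprod (f ∘ₗ p₁) l) ∘ₗ e.toLinearMap
  have hpe : ∀ x, p (e.symm x) = f (p₁ x.1) + l x.2 := fun x => by simp [p]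
  have hgl : ∀ x, g (l x) = p₂ x := fun x => LinearMap.congr_fun hl x
  have hgf : ∀ x, g (f x) = 0 := hfg.apply_apply_eq_zero
  have hp : Function.Surjective p := by
    intro y
    obtain ⟨x₂, hx₂⟩ := hp₂ (g y)
    obtain ⟨x, hx⟩ := (hfg (y - l x₂)).1 (by rw [map_sub, hgl, hx₂, sub_self])
    obtain ⟨x₁, rfl⟩ := hp₁ x
    exact ⟨e.symm (x₁, x₂), by rw [hpe, hx, sub_add_cancel]⟩
  refine ⟨r₁ + r₂, ModuleCat.of A (LinearMap.ker p), (LinearMap.ker p).subtype, p,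
    Subtype.val_injective, hp, LinearMap.exact_subtype_ker_map p, K₁, K₂, ?_⟩
  let a : K₁ →ₗ[A] LinearMap.ker p := LinearMap.codRestrict _
    (e.symm.toLinearMap ∘ₗ LinearMap.inl A _ _ ∘ₗ i₁) (fun x => by
      simp [hpe, he₁.apply_apply_eq_zero])
  have ha : ∀ k, e (a k).1 = (i₁ k, 0) := fun k => e.apply_symm_apply _
  obtain ⟨b, hb⟩ := exists_lift_of_exact hi₂ he₂
    (LinearMap.snd A _ _ ∘ₗ e.toLinearMap ∘ₗ (LinearMap.ker p).subtype) (by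
      ext x
      obtain ⟨x, hx⟩ := x
      obtain ⟨x, rfl⟩ := e.symm.surjective x
      have := congrArg g (LinearMap.mem_ker.1 hx)
      rw [hpe, map_add, hgf, hgl, zero_add, map_zero] at this
      simpa using this)
  have hb' : ∀ x, i₂ (b x) = (e x.1).2 := fun x => LinearMap.congr_fun hb x
  refine ⟨a, b, hK₁, hK₂, ?_, ?_, ?_⟩
  · intro x y hxy
    have := congrArg (fun z => (e (Subtype.val z)).1) hxy
    exact hi₁ (by simpa only [ha] using this)
  · intro y
    obtain ⟨x, hx⟩ := (hfg (l (i₂ y))).1 (by rw [hgl, he₂.apply_apply_eq_zero])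
    obtain ⟨x, rfl⟩ := hp₁ x
    refine ⟨⟨e.symm (-x, i₂ y), ?_⟩, hi₂ ?_⟩
    · rw [LinearMap.mem_ker, hpe, ← hx]
      simp
    · rw [hb']
      simp
  · intro x
    constructor
    · intro hx
      have h2 : (e x.1).2 = 0 := by rw [← hb', hx, map_zero]
      have hx' := LinearMap.mem_ker.1 x.2
      rw [← e.symm_apply_apply x.1, hpe, h2, map_zero, add_zero] at hx'
      obtain ⟨k, hk⟩ := (he₁ (e x.1).1).1 (hf (by rw [hx', map_zero]))
      refine ⟨k, Subtype.ext (e.injective ?_)⟩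
      rw [ha]
      exact Prod.ext hk h2.symm
    · rintro ⟨k, rfl⟩
      refine hi₂ ?_
      rw [hb', ha, map_zero]

/-- The cokernel of a monomorphism between modules with resolutions by finitely generated free
modules has such a resolution. -/
lemma FPInf.cokernel {M' M'' : Type u} [AddCommGroup M'] [Module A M'] [AddCommGroup M'']
    [Module A M''] (h' : FPInf A M') (h : FPInf A M) (f : M' →ₗ[A] M) (g : M →ₗ[A] M'')
    (hf : Function.Injective f) (hg : Function.Surjective g) (hfg : Function.Exact f g) :
    FPInf A M'' := by
  obtain ⟨r, K, i, p, hi, hp, he, hK⟩ := h.hasCover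
  -- The free cover of `M` also covers `M''`. The new kernel is an extension of `M'` by `K`: `p`
  -- maps it onto the image of `f`, with kernel `K`.
  refine FPInf.of_hasCover ⟨r, ModuleCat.of A (LinearMap.ker (g ∘ₗ p)),
    (LinearMap.ker (g ∘ₗ p)).subtype, g ∘ₗ p, Subtype.val_injective, hg.comp hp,
    LinearMap.exact_subtype_ker_map _, ?_⟩
  let a : K →ₗ[A] LinearMap.ker (g ∘ₗ p) := LinearMap.codRestrict _ i (fun x => by
    simp [he.apply_apply_eq_zero])
  obtain ⟨b, hb⟩ := exists_lift_of_exact hf hfg (p ∘ₗ (LinearMap.ker (g ∘ₗ p)).subtype) (by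
    ext x
    exact x.2)
  have hb' : ∀ x, f (b x) = p x.1 := fun x => LinearMap.congr_fun hb x
  refine FPInf.extension hK h' a b ?_ ?_ ?_
  · intro x y hxy
    exact hi (congrArg Subtype.val hxy)
  · intro y
    obtain ⟨x, hx⟩ := hp (f y)
    refine ⟨⟨x, ?_⟩, hf ?_⟩
    · rw [LinearMap.mem_ker, LinearMap.comp_apply, hx, hfg.apply_apply_eq_zero]
    · rw [hb', hx]
  · intro x
    constructor
    · intro hx
      obtain ⟨k, hk⟩ := (he x.1).1 (by rw [← hb', hx, map_zero])
      exact ⟨k, Subtype.ext hk⟩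
    · rintro ⟨k, rfl⟩
      refine hf ?_
      rw [hb', map_zero]
      exact he.apply_apply_eq_zero k

lemma FPInf.finPow (h : FPInf A M) (r : ℕ) : FPInf A (Fin r → M) := by
  induction r with
  | zero => exact FPInf.of_subsingleton
  | succ r ih =>
    refine FPInf.extension h ih (LinearMap.single A (fun _ => M) 0)
      (LinearMap.funLeft A M Fin.succ) (Pi.single_injective (M := fun _ => M) 0) ?_ ?_
    · exact LinearMap.funLeft_surjective_of_injective A M _ (Fin.succ_injective r)
    · intro x
      constructor
      · intro hx
        refine ⟨x 0, funext fun j => ?_⟩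
        refine Fin.cases (by simp) (fun j => ?_) j
        simpa using (congrFun hx j).symm
      · rintro ⟨y, rfl⟩
        ext j
        simp [LinearMap.funLeft_apply]

/-- A module with a resolution by finitely generated projective modules, given by a class closed
under passing to suitable syzygies, has a resolution by finitely generated free modules. -/
lemma FPInf.of_projective_covers (𝒮 : ObjectProperty (ModuleCat.{u} A))
    (h : ∀ Z : ModuleCat.{u} A, 𝒮 Z → ∃ (P K : ModuleCat.{u} A) (i : K →ₗ[A] P) (p : P →ₗ[A] Z),
      Module.Finite A P ∧ Module.Projective A P ∧
      Function.Injective i ∧ Function.Surjective p ∧ Function.Exact i p ∧ 𝒮 K)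
    (hM : 𝒮 (ModuleCat.of A M)) : FPInf A M := by
  -- Adding a finitely generated projective summand `Q` makes the class closed under kernels of free
  -- covers. If `P` covers `Z` with kernel `K`, then `P × Q` is a summand of some `A ^ n` with
  -- complement `ker f`, and the kernel of `A ^ n → Z × Q` is `K × ker f`.
  refine FPInf.coinduction (fun N => ∃ (Z Q : ModuleCat.{u} A) (_ : N ≃ₗ[A] Z × Q),
    𝒮 Z ∧ Module.Finite A Q ∧ Module.Projective A Q) ?_
    ⟨ModuleCat.of A M, ModuleCat.of A PUnit.{u + 1},
      (LinearEquiv.prodUnique (R := A) (M := M) (M₂ := PUnit.{u + 1})).symm, hM,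
      inferInstanceAs (Module.Finite A PUnit.{u + 1}),
      inferInstanceAs (Module.Projective A PUnit.{u + 1})⟩
  rintro N ⟨Z, Q, e, hZ, hQ, hQ'⟩
  obtain ⟨P, K, i, p, hP, hP', hi, hp, he, hK⟩ := h Z hZ
  obtain ⟨n, f, g, hf, hg, hfg⟩ := Module.Finite.exists_comp_eq_id_of_projective A (P × Q)
  have hfg' : ∀ x, f (g x) = x := fun x => LinearMap.congr_fun hfg x
  -- The projection onto the complement, which shows that `ker f` is finitely generated projective.
  let s : (Fin n → A) →ₗ[A] LinearMap.ker f := LinearMap.codRestrict _ (LinearMap.id - g ∘ₗ f)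
    (fun x => by simp [hfg'])
  have hs : s ∘ₗ (LinearMap.ker f).subtype = LinearMap.id := by
    ext x
    simp [s]
  have hs' : Function.Surjective s := fun x => ⟨x.1, LinearMap.congr_fun hs x⟩
  refine ⟨n, ModuleCat.of A (K × LinearMap.ker f),
    LinearMap.coprod (g ∘ₗ LinearMap.inl A P Q ∘ₗ i) (LinearMap.ker f).subtype,
    e.symm.toLinearMap ∘ₗ LinearMap.prodMap p LinearMap.id ∘ₗ f, ?_, ?_, ?_,
    K, ModuleCat.of A (LinearMap.ker f), LinearEquiv.refl A _, hK, ?_, ?_⟩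
  · refine (injective_iff_map_eq_zero _).2 ?_
    rintro ⟨k, q, hq⟩ hx
    simp only [LinearMap.coprod_apply, LinearMap.comp_apply, LinearMap.inl_apply,
      Submodule.subtype_apply] at hx
    have h1 := congrArg f hx
    rw [map_add, hfg', LinearMap.mem_ker.1 hq, add_zero, map_zero] at h1
    have hk : k = 0 := hi (by rw [map_zero]; exact congrArg Prod.fst h1)
    subst hk
    rw [map_zero, show ((0 : P), (0 : Q)) = 0 from rfl, map_zero, zero_add] at hx
    subst hx
    rfl
  · exact e.symm.surjective.comp ((Function.Surjective.prodMap hp Function.surjective_id).comp hf)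
  · intro x
    constructor
    · intro hx
      have hx' : LinearMap.prodMap p LinearMap.id (f x) = 0 :=
        e.symm.injective (by rw [map_zero]; exact hx)
      obtain ⟨k, hk⟩ := (he (f x).1).1 (congrArg Prod.fst hx')
      have h2 : (f x).2 = 0 := congrArg Prod.snd hx'
      refine ⟨(k, s x), ?_⟩
      have : (i k, (0 : Q)) = f x := Prod.ext hk h2.symm
      simp [this, s]
    · rintro ⟨⟨k, q, hq⟩, rfl⟩
      simp [hfg', LinearMap.mem_ker.1 hq, he.apply_apply_eq_zero]
  · exact Module.Finite.of_surjective s hs'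
  · exact Module.Projective.of_split _ s hs

lemma HasDegreewiseFiniteResolution.fpInf (h : HasDegreewiseFiniteResolution A M) :
    FPInf A M := by
  obtain ⟨P, hP⟩ := h
  -- The class of cokernels of the differentials. The kernel of the cover is the image of a
  -- differential, which by exactness is the cokernel of the next one.
  refine FPInf.of_projective_covers (fun Z => ∃ (n : ℕ) (p : P.complex.X n →ₗ[A] Z),
    Function.Surjective p ∧ Function.Exact (P.complex.d (n + 1) n).hom p) ?_ ?_
  · rintro Z ⟨n, p, hp, he⟩
    refine ⟨P.complex.X n, ModuleCat.of A (LinearMap.range (P.complex.d (n + 1) n).hom),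
      Submodule.subtype _, p, hP n, (IsProjective.iff_projective _).2 (P.projective n),
      Subtype.val_injective, hp, ?_, n + 1, LinearMap.rangeRestrict _,
      LinearMap.surjective_rangeRestrict _, ?_⟩
    · intro x
      rw [he x]
      simp
    · have := (ShortComplex.ShortExact.moduleCat_exact_iff_function_exact _).1 (P.exact_succ n)
      intro x
      rw [← this x]
      exact Subtype.ext_iff
  · refine ⟨0, (P.π.f 0).hom, ?_, ?_⟩
    · exact (ModuleCat.epi_iff_surjective (P.π.f 0)).1 inferInstance
    · exact (ShortComplex.ShortExact.moduleCat_exact_iff_function_exact _).1 P.exact₀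

end FreeResolutions

end

noncomputable section

/-! ### Vanishing of Ext and Tor in terms of syzygies -/

section Ext

open Abelian

variable {A : Type u} [Ring A] {K F Z N : Type u} [AddCommGroup K] [Module A K] [AddCommGroup F]
  [Module A F] [AddCommGroup Z] [Module A Z] [AddCommGroup N] [Module A N]
  {i : K →ₗ[A] F} {p : F →ₗ[A] Z}

/-- The short exact sequence of module categories given by linear maps. -/
lemma shortExact_of (hi : Function.Injective i) (hp : Function.Surjective p)
    (he : Function.Exact i p) :
    (ShortComplex.mk (ModuleCat.ofHom i) (ModuleCat.ofHom p)
      (ModuleCat.hom_ext he.linearMap_comp_eq_zero)).ShortExact where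
  exact := (ShortComplex.ShortExact.moduleCat_exact_iff_function_exact _).2 he
  mono_f := (ModuleCat.mono_iff_injective _).2 hi
  epi_g := (ModuleCat.epi_iff_surjective _).2 hp

/-- As `F` is projective, the long exact sequence identifies `Ext^1(Z, N)` with the cokernel of the
restriction `Hom(F, N) → Hom(K, N)`. -/
lemma subsingleton_ext_one_iff [Module.Projective A F] (hi : Function.Injective i)
    (hp : Function.Surjective p) (he : Function.Exact i p) :
    Subsingleton (Ext (ModuleCat.of A Z) (ModuleCat.of A N) 1) ↔
      ∀ f : K →ₗ[A] N, ∃ g : F →ₗ[A] N, g ∘ₗ i = f := by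
  have hS := shortExact_of hi hp he
  have : Projective (ModuleCat.of A F) := (IsProjective.iff_projective F).1 inferInstance
  constructor
  · intro h f
    obtain ⟨x, hx⟩ := Ext.contravariant_sequence_exact₁ hS (ModuleCat.of A N)
      (Ext.mk₀ (ModuleCat.ofHom f)) (add_zero 1) (Subsingleton.elim _ _)
    obtain ⟨g, rfl⟩ := (Ext.mk₀_bijective _ _).2 x
    rw [Ext.mk₀_comp_mk₀] at hx
    exact ⟨g.hom, congrArg ModuleCat.Hom.hom ((Ext.mk₀_bijective _ _).1 hx)⟩
  · intro h
    refine subsingleton_of_forall_eq 0 fun x => ?_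
    obtain ⟨y, rfl⟩ := Ext.contravariant_sequence_exact₃ hS (ModuleCat.of A N) x
      (Ext.eq_zero_of_projective _) (add_zero 1)
    obtain ⟨f, rfl⟩ := (Ext.mk₀_bijective _ _).2 y
    obtain ⟨g, hg⟩ := h f.hom
    have : f = ModuleCat.ofHom i ≫ ModuleCat.ofHom g := ModuleCat.hom_ext hg.symm
    rw [this, ← Ext.mk₀_comp_mk₀]
    exact hS.extClass_comp_assoc _

/-- Dimension shifting along a projective middle term. -/
lemma subsingleton_ext_succ_iff [Module.Projective A F] (hi : Function.Injective i)
    (hp : Function.Surjective p) (he : Function.Exact i p) (j : ℕ) :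
    Subsingleton (Ext (ModuleCat.of A Z) (ModuleCat.of A N) (j + 2)) ↔
      Subsingleton (Ext (ModuleCat.of A K) (ModuleCat.of A N) (j + 1)) := by
  have hS := shortExact_of hi hp he
  have : Projective (ModuleCat.of A F) := (IsProjective.iff_projective F).1 inferInstance
  have hj : 1 + (j + 1) = j + 2 := by omega
  constructor
  · intro h
    refine subsingleton_of_forall_eq 0 fun x => ?_
    obtain ⟨y, rfl⟩ := Ext.contravariant_sequence_exact₁ hS (ModuleCat.of A N) x hj
      (Subsingleton.elim _ _)
    rw [Ext.eq_zero_of_projective y, Ext.comp_zero]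
  · intro h
    refine subsingleton_of_forall_eq 0 fun x => ?_
    obtain ⟨y, rfl⟩ := Ext.contravariant_sequence_exact₃ hS (ModuleCat.of A N) x
      (Ext.eq_zero_of_projective _) hj
    rw [Subsingleton.elim y 0, Ext.comp_zero]

lemma ExtVanishes.of_equiv_left {M M' : Type u} [AddCommGroup M] [Module A M] [AddCommGroup M']
    [Module A M'] (e : M ≃ₗ[A] M') (h : ExtVanishes A M N) : ExtVanishes A M' N := by
  intro j hj
  have := h j hj
  refine subsingleton_of_forall_eq 0 fun x => ?_
  have hx : (Ext.mk₀ e.symm.toModuleIso.hom).comp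
      ((Ext.mk₀ e.toModuleIso.hom).comp x (zero_add j)) (zero_add j) = x := by
    rw [Ext.mk₀_comp_mk₀_assoc]
    have he : e.symm.toModuleIso.hom ≫ e.toModuleIso.hom = 𝟙 (ModuleCat.of A M') :=
      ModuleCat.hom_ext (by ext; simp)
    rw [he, Ext.mk₀_id_comp]
  rw [← hx, Subsingleton.elim ((Ext.mk₀ e.toModuleIso.hom).comp x (zero_add j)) 0, Ext.comp_zero]

lemma ExtVanishes.of_equiv_right {M M' : Type u} [AddCommGroup M] [Module A M] [AddCommGroup M']
    [Module A M'] (e : M ≃ₗ[A] M') (h : ExtVanishes A N M) : ExtVanishes A N M' := by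
  intro j hj
  have := h j hj
  refine subsingleton_of_forall_eq 0 fun x => ?_
  have hx : (x.comp (Ext.mk₀ e.symm.toModuleIso.hom) (add_zero j)).comp
      (Ext.mk₀ e.toModuleIso.hom) (add_zero j) = x := by
    rw [Ext.comp_assoc_of_third_deg_zero, Ext.mk₀_comp_mk₀]
    have he : e.symm.toModuleIso.hom ≫ e.toModuleIso.hom = 𝟙 (ModuleCat.of A M') :=
      ModuleCat.hom_ext (by ext; simp)
    rw [he, Ext.comp_mk₀_id]
  rw [← hx, Subsingleton.elim (x.comp (Ext.mk₀ e.symm.toModuleIso.hom) (add_zero j)) 0,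
    Ext.zero_comp]

/-- Higher Ext groups of `M` with values in `N` vanish if and only if all maps from syzygies of
`M` to `N` extend to the free modules of the resolution. -/
lemma FreeRes.extVanishes_iff {M : Type u} [AddCommGroup M] [Module A M] (P : FreeRes A M) :
    ExtVanishes A M N ↔
      ∀ n, ∀ f : P.K (n + 1) →ₗ[A] N, ∃ g : (Fin (P.rk n) → A) →ₗ[A] N, g ∘ₗ P.i n = f := by
  -- `Ext^{j+1}(K_n, N) ≅ Ext^1(K_{n+j}, N)` by shifting. The separate variable `m` avoids transport
  -- along equalities of indices.
  have key : ∀ j n m : ℕ, m = n + j →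
      (Subsingleton (Ext (ModuleCat.of A (P.K n)) (ModuleCat.of A N) (j + 1)) ↔
        ∀ f : P.K (m + 1) →ₗ[A] N, ∃ g : (Fin (P.rk m) → A) →ₗ[A] N, g ∘ₗ P.i m = f) := by
    intro j
    induction j with
    | zero =>
      intro n m hm
      obtain rfl : m = n := hm
      exact subsingleton_ext_one_iff (P.injective_i m) (P.surjective_p m) (P.exact m)
    | succ j ih =>
      intro n m hm
      rw [subsingleton_ext_succ_iff (P.injective_i n) (P.surjective_p n) (P.exact n) j]
      exact ih (n + 1) m (by omega)
  constructor
  · intro h n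
    exact (key n 0 n (by omega)).1 (h.of_equiv_left P.e.symm (n + 1) (by omega))
  · intro h
    refine ExtVanishes.of_equiv_left P.e fun j hj => ?_
    obtain ⟨j, rfl⟩ := Nat.exists_eq_add_of_le' hj
    exact (key j 0 j (by omega)).2 (h j)

variable {M : Type u} [AddCommGroup M] [Module A M]

lemma ExtVanishes.exists_lift (hi : Function.Injective i) (hp : Function.Surjective p)
    (he : Function.Exact i p) (hK : ExtVanishes A M K) (f : M →ₗ[A] Z) :
    ∃ g : M →ₗ[A] F, p ∘ₗ g = f := by
  have hS := shortExact_of hi hp he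
  have := hK 1 le_rfl
  obtain ⟨x, hx⟩ := Ext.covariant_sequence_exact₃ (ModuleCat.of A M) hS
    (Ext.mk₀ (ModuleCat.ofHom f)) (zero_add 1) (Subsingleton.elim _ _)
  obtain ⟨g, rfl⟩ := (Ext.mk₀_bijective _ _).2 x
  rw [Ext.mk₀_comp_mk₀] at hx
  exact ⟨g.hom, congrArg ModuleCat.Hom.hom ((Ext.mk₀_bijective _ _).1 hx)⟩

lemma ExtVanishes.cokernel (hi : Function.Injective i) (hp : Function.Surjective p)
    (he : Function.Exact i p) (hK : ExtVanishes A M K) (hF : ExtVanishes A M F) :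
    ExtVanishes A M Z := by
  have hS := shortExact_of hi hp he
  intro j hj
  have := hK (j + 1) (by omega)
  have := hF j hj
  refine subsingleton_of_forall_eq 0 fun x => ?_
  obtain ⟨y, rfl⟩ := Ext.covariant_sequence_exact₃ (ModuleCat.of A M) hS x rfl
    (Subsingleton.elim _ _)
  rw [Subsingleton.elim y 0, Ext.zero_comp]

lemma ExtVanishes.kernel (hi : Function.Injective i) (hp : Function.Surjective p)
    (he : Function.Exact i p) (hF : ExtVanishes A M F) (hZ : ExtVanishes A M Z)
    (hl : ∀ f : M →ₗ[A] Z, ∃ g : M →ₗ[A] F, p ∘ₗ g = f) :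
    ExtVanishes A M K := by
  have hS := shortExact_of hi hp he
  intro j hj
  have := hF j hj
  refine subsingleton_of_forall_eq 0 fun x => ?_
  obtain ⟨j, rfl⟩ := Nat.exists_eq_add_of_le' hj
  obtain ⟨y, rfl⟩ := Ext.covariant_sequence_exact₁ (ModuleCat.of A M) hS x
    (Subsingleton.elim _ _) rfl
  -- In degree one the class is the connecting image of a map `M → Z`, which dies because `hl` lifts
  -- that map to `F`. In higher degrees `Ext(M, Z)` already vanishes.
  cases j with
  | zero =>
    obtain ⟨f, rfl⟩ := (Ext.mk₀_bijective _ _).2 y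
    obtain ⟨g, hg⟩ := hl f.hom
    have : f = ModuleCat.ofHom g ≫ ModuleCat.ofHom p := ModuleCat.hom_ext hg.symm
    rw [this, ← Ext.mk₀_comp_mk₀]
    rw [Ext.comp_assoc_of_second_deg_zero]
    erw [hS.comp_extClass]
    rw [Ext.comp_zero]
  | succ j =>
    have := hZ (j + 1) (by omega)
    rw [Subsingleton.elim y 0, Ext.zero_comp]

end Ext

/-! ### Tor computed from a resolution by finitely generated free modules -/

section Tor

variable {A : Type u} [Ring A] {M : Type u} [AddCommGroup M] [Module A M]

/-- The chain complex of a resolution by finitely generated free modules. -/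
def FreeRes.complex (P : FreeRes A M) : ChainComplex (ModuleCat.{u} A) ℕ :=
  ChainComplex.of (fun n => ModuleCat.of A (Fin (P.rk n) → A))
    (fun n => ModuleCat.ofHom (P.i n ∘ₗ P.p (n + 1)))
    (fun n => ModuleCat.hom_ext (P.exact_d n).linearMap_comp_eq_zero)

lemma FreeRes.complex_d (P : FreeRes A M) (n : ℕ) :
    P.complex.d (n + 1) n = ModuleCat.ofHom (P.i n ∘ₗ P.p (n + 1)) :=
  ChainComplex.of_d (fun n => ModuleCat.of A (Fin (P.rk n) → A))
    (fun n => ModuleCat.ofHom (P.i n ∘ₗ P.p (n + 1))) n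

lemma chainComplex_exactAt_succ_iff {V : Type*} [Category V] [Abelian V] (X : ChainComplex V ℕ)
    (n : ℕ) : X.ExactAt (n + 1) ↔
      (ShortComplex.mk _ _ (X.d_comp_d (n + 2) (n + 1) n)).Exact :=
  X.exactAt_iff' (n + 2) (n + 1) n (by simp only [ChainComplex.prev]; rfl) (by simp)

/-- The projective resolution given by a resolution by finitely generated free modules. -/
def FreeRes.projectiveResolution (P : FreeRes A M) :
    ProjectiveResolution (ModuleCat.of A M) where
  complex := P.complex
  projective n := (IsProjective.iff_projective (Fin (P.rk n) → A)).1 inferInstance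
  π := (ChainComplex.toSingle₀Equiv _ _).symm ⟨ModuleCat.ofHom (P.e.toLinearMap ∘ₗ P.p 0), by
    rw [P.complex_d]
    exact ModuleCat.hom_ext P.exact_ε.linearMap_comp_eq_zero⟩
  quasiIso := ⟨fun n => by
    cases n
    · rw [ChainComplex.quasiIsoAt₀_iff, ShortComplex.quasiIso_iff_of_zeros']
      · refine (ShortComplex.exact_and_epi_g_iff_of_iso
          (S₂ := ShortComplex.mk (ModuleCat.ofHom (P.i 0 ∘ₗ P.p 1))
            (ModuleCat.ofHom (P.e.toLinearMap ∘ₗ P.p 0))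
            (ModuleCat.hom_ext P.exact_ε.linearMap_comp_eq_zero)) ?_).2
          ⟨(ShortComplex.ShortExact.moduleCat_exact_iff_function_exact _).2 P.exact_ε,
            (ModuleCat.epi_iff_surjective _).2 (P.e.surjective.comp (P.surjective_p 0))⟩
        exact ShortComplex.isoMk (Iso.refl _) (Iso.refl _) (Iso.refl _)
          (by
            change 𝟙 _ ≫ ModuleCat.ofHom _ = P.complex.d 1 0 ≫ 𝟙 _
            rw [Category.id_comp, Category.comp_id]
            exact (P.complex_d 0).symm)
          (by
            refine (Category.id_comp _).trans ?_
            refine Eq.trans ?_ (Category.comp_id _).symm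
            exact (ChainComplex.toSingle₀Equiv_symm_apply_f_zero (C := P.complex)
              (X := ModuleCat.of A M) _ _).symm)
      all_goals rfl
    · rw [quasiIsoAt_iff_exactAt']
      · rw [chainComplex_exactAt_succ_iff,
          ShortComplex.ShortExact.moduleCat_exact_iff_function_exact]
        change Function.Exact (P.complex.d _ _).hom (P.complex.d _ _).hom
        rw [P.complex_d, P.complex_d]
        exact P.exact_d _
      · apply ChainComplex.exactAt_succ_single_obj⟩

end Tor

section Tor

variable {R : Type u} [Ring R] {C : Type u} [AddCommGroup C] [Module Rᵐᵒᵖ C]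
  {M : Type u} [AddCommGroup M] [Module R M]

lemma FreeRes.subsingleton_tor_iff (P : FreeRes Rᵐᵒᵖ C) (n : ℕ) :
    Subsingleton (Tor R C M (n + 1)) ↔
      Function.Exact (Tens.map R (P.i (n + 1) ∘ₗ P.p (n + 2)) (LinearMap.id : M →ₗ[R] M))
        (Tens.map R (P.i n ∘ₗ P.p (n + 1)) (LinearMap.id : M →ₗ[R] M)) := by
  rw [← AddCommGrpCat.isZero_iff_subsingleton, Tor,
    (P.projectiveResolution.isoLeftDerivedObj (tensorRight R M) (n + 1)).isZero_iff]
  change Limits.IsZero (HomologicalComplex.homology _ (n + 1)) ↔ _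
  rw [← HomologicalComplex.exactAt_iff_isZero_homology, chainComplex_exactAt_succ_iff,
    ShortComplex.ab_exact_iff_function_exact]
  change Function.Exact ((tensorRight R M).map (P.complex.d (n + 2) (n + 1)))
    ((tensorRight R M).map (P.complex.d (n + 1) n)) ↔ _
  rw [P.complex_d, P.complex_d]
  rfl

/-- By right exactness the incoming differential has as image the kernel of `p (n + 1) ⊗ M`, and `p
(n + 1) ⊗ M` is onto `K (n + 1) ⊗ M`. So exactness in degree `n + 1` says precisely that `i n ⊗ M`
has no kernel. This turns vanishing of Tor into a condition that `fp_n`-flatness can test. -/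
lemma FreeRes.torVanishes_iff (P : FreeRes Rᵐᵒᵖ C) :
    TorVanishes R C M ↔
      ∀ n, Function.Injective (Tens.map R (P.i n) (LinearMap.id : M →ₗ[R] M)) := by
  have key : ∀ n, Subsingleton (Tor R C M (n + 1)) ↔
      Function.Injective (Tens.map R (P.i n) (LinearMap.id : M →ₗ[R] M)) := by
    intro n
    have hex := Tens.exact_map_left (M := M) (P.exact (n + 1)) (P.surjective_p (n + 1))
    have h1 := Tens.map_surjective (R := R) (P.surjective_p (n + 1))
      (g := (LinearMap.id : M →ₗ[R] M)) Function.surjective_id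
    have h2 := Tens.map_surjective (R := R) (P.surjective_p (n + 2))
      (g := (LinearMap.id : M →ₗ[R] M)) Function.surjective_id
    have hc1 : ∀ t : Tens R (Fin (P.rk (n + 1)) → Rᵐᵒᵖ) M,
        Tens.map R (P.i n ∘ₗ P.p (n + 1)) LinearMap.id t =
        Tens.map R (P.i n) LinearMap.id (Tens.map R (P.p (n + 1)) LinearMap.id t) :=
      fun t => (Tens.map_map_left _ _ t).symm
    have hc2 : ∀ t : Tens R (Fin (P.rk (n + 2)) → Rᵐᵒᵖ) M,
        Tens.map R (P.i (n + 1) ∘ₗ P.p (n + 2)) LinearMap.id t =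
        Tens.map R (P.i (n + 1)) LinearMap.id (Tens.map R (P.p (n + 2)) LinearMap.id t) :=
      fun t => (Tens.map_map_left _ _ t).symm
    rw [P.subsingleton_tor_iff]
    constructor
    · intro h
      refine (injective_iff_map_eq_zero _).2 fun t ht => ?_
      obtain ⟨t, rfl⟩ := h1 t
      rw [← hc1] at ht
      obtain ⟨z, rfl⟩ := (h t).1 ht
      rw [hc2, hex.apply_apply_eq_zero]
    · intro h t
      rw [hc1, map_eq_zero_iff _ h, hex t]
      constructor
      · rintro ⟨z, rfl⟩
        obtain ⟨z, rfl⟩ := h2 z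
        exact ⟨z, hc2 z⟩
      · rintro ⟨z, rfl⟩
        exact ⟨_, (hc2 z).symm⟩
  constructor
  · exact fun h n => (key n).1 (h (n + 1) (by omega))
  · intro h j hj
    obtain ⟨j, rfl⟩ := Nat.exists_eq_add_of_le' hj
    exact (key j).2 (h j)

end Tor

end

noncomputable section

/-! ### Vanishing of Tor in short exact sequences -/

section TorSequences

variable {R : Type u} [Ring R] {C : Type u} [AddCommGroup C] [Module Rᵐᵒᵖ C]
  {X Y Z : Type u} [AddCommGroup X] [Module R X] [AddCommGroup Y] [Module R Y] [AddCommGroup Z]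
  [Module R Z] {f : X →ₗ[R] Y} {g : Y →ₗ[R] Z}

lemma TorVanishes.of_equiv (e : X ≃ₗ[R] Y) (hC : FPInf Rᵐᵒᵖ C) (h : TorVanishes R C X) :
    TorVanishes R C Y := by
  obtain ⟨P⟩ := hC
  rw [P.torVanishes_iff] at h ⊢
  intro n
  have he := Tens.map_bijective (LinearEquiv.refl Rᵐᵒᵖ (P.K (n + 1))) e
  have he' := Tens.map_bijective (LinearEquiv.refl Rᵐᵒᵖ (Fin (P.rk n) → Rᵐᵒᵖ)) e
  refine (injective_iff_map_eq_zero _).2 fun t ht => ?_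
  obtain ⟨t, rfl⟩ := he.2 t
  have : Tens.map R (P.i n) LinearMap.id t = 0 := by
    apply he'.1
    rw [map_zero, ← ht]
    exact (Tens.map_comm _ _ _).symm
  rw [h n (this.trans (map_zero _).symm), map_zero]

/-- The chase behind `Tor_1(K_n, Z) = 0`, in the diagram of `0 → K_{n+1} → F_n → K_n → 0` tensored
with `X → Y → Z`: `i n ⊗ Z` is injective by hypothesis and `F_n ⊗ f` by freeness. -/
lemma FreeRes.injective_map_of_torVanishes (P : FreeRes Rᵐᵒᵖ C) (hf : Function.Injective f)
    (hg : Function.Surjective g) (hfg : Function.Exact f g) (hZ : TorVanishes R C Z) (n : ℕ) :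
    Function.Injective (Tens.map R (LinearMap.id : P.K n →ₗ[Rᵐᵒᵖ] P.K n) f) := by
  rw [P.torVanishes_iff] at hZ
  refine (injective_iff_map_eq_zero _).2 fun x hx => ?_
  obtain ⟨y, rfl⟩ := Tens.map_surjective (R := R) (P.surjective_p n)
    (g := (LinearMap.id : X →ₗ[R] X)) Function.surjective_id x
  rw [← Tens.map_comm] at hx
  obtain ⟨z, hz⟩ := (Tens.exact_map_left (P.exact n) (P.surjective_p n) _).1 hx
  have hz' : Tens.map R LinearMap.id g z = 0 := by
    apply hZ n
    rw [Tens.map_comm, hz, map_zero, (Tens.exact_map_right hfg hg).apply_apply_eq_zero]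
  obtain ⟨w, rfl⟩ := (Tens.exact_map_right hfg hg _).1 hz'
  rw [Tens.map_comm] at hz
  have := Tens.map_injective_of_free hf hz
  rw [← this, (Tens.exact_map_left (P.exact n) (P.surjective_p n)).apply_apply_eq_zero]

/-- If `Tor_1^R(C, Z) = 0`, then `C ⊗_R -` preserves the exactness of `0 → X → Y → Z → 0`. -/
lemma TorVanishes.injective_map (hC : FPInf Rᵐᵒᵖ C) (hf : Function.Injective f)
    (hg : Function.Surjective g) (hfg : Function.Exact f g) (hZ : TorVanishes R C Z) :
    Function.Injective (Tens.map R (LinearMap.id : C →ₗ[Rᵐᵒᵖ] C) f) := by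
  obtain ⟨P⟩ := hC
  have h := P.injective_map_of_torVanishes hf hg hfg hZ 0
  have heX := Tens.map_bijective P.e (LinearEquiv.refl R X)
  have heY := Tens.map_bijective P.e (LinearEquiv.refl R Y)
  refine (injective_iff_map_eq_zero _).2 fun x hx => ?_
  obtain ⟨x, rfl⟩ := heX.2 x
  have : Tens.map R LinearMap.id f x = 0 := by
    apply heY.1
    rw [map_zero, ← hx]
    exact Tens.map_comm _ _ _
  rw [h (this.trans (map_zero _).symm), map_zero]

/-- The composite `K_{n+1} ⊗ X → K_{n+1} ⊗ Y → F_n ⊗ Y` is injective and factors through `i n ⊗ X`.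
-/
lemma TorVanishes.kernel (hC : FPInf Rᵐᵒᵖ C) (hf : Function.Injective f)
    (hg : Function.Surjective g) (hfg : Function.Exact f g) (hY : TorVanishes R C Y)
    (hZ : TorVanishes R C Z) : TorVanishes R C X := by
  obtain ⟨P⟩ := hC
  have h := P.injective_map_of_torVanishes hf hg hfg hZ
  rw [P.torVanishes_iff] at hY ⊢
  intro n
  refine (injective_iff_map_eq_zero _).2 fun x hx => ?_
  refine h (n + 1) (hY n ?_)
  rw [Tens.map_comm, hx, map_zero, map_zero, map_zero]

/-- Given `Tor_1(C, Y) = 0`, the group `Tor_1(C, Z)` is the kernel of `C ⊗ f`, whence the hypothesis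
`hinj`. -/
lemma TorVanishes.cokernel (hC : FPInf Rᵐᵒᵖ C) (hf : Function.Injective f)
    (hg : Function.Surjective g) (hfg : Function.Exact f g) (hX : TorVanishes R C X)
    (hY : TorVanishes R C Y)
    (hinj : Function.Injective (Tens.map R (LinearMap.id : C →ₗ[Rᵐᵒᵖ] C) f)) :
    TorVanishes R C Z := by
  obtain ⟨P⟩ := hC
  rw [P.torVanishes_iff] at hX hY ⊢
  -- For `K 0 ≅ C` this is `hinj`. For later syzygies use `K_{n+1} ⊗ X → F_n ⊗ X → F_n ⊗ Y`, both
  -- injective.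
  have h : ∀ n, Function.Injective (Tens.map R (LinearMap.id : P.K n →ₗ[Rᵐᵒᵖ] P.K n) f) := by
    intro n
    refine (injective_iff_map_eq_zero _).2 fun x hx => ?_
    cases n with
    | zero =>
      apply (Tens.map_bijective P.e (LinearEquiv.refl R X)).1
      apply hinj
      rw [map_zero, map_zero]
      refine (Tens.map_comm P.e.toLinearMap f x).symm.trans ?_
      rw [hx, map_zero]
    | succ n =>
      apply hX n
      apply Tens.map_injective_of_free hf
      rw [← Tens.map_comm, hx, map_zero, map_zero, map_zero]
  intro n
  refine (injective_iff_map_eq_zero _).2 fun x hx => ?_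
  obtain ⟨y, rfl⟩ := Tens.map_surjective (R := R) (f := (LinearMap.id : P.K (n + 1) →ₗ[Rᵐᵒᵖ] _))
    Function.surjective_id hg x
  rw [Tens.map_comm] at hx
  obtain ⟨z, hz⟩ := (Tens.exact_map_right hfg hg _).1 hx
  have hz' : Tens.map R (P.p n) LinearMap.id z = 0 := by
    apply h n
    rw [← Tens.map_comm, hz, map_zero,
      (Tens.exact_map_left (P.exact n) (P.surjective_p n)).apply_apply_eq_zero]
  obtain ⟨w, rfl⟩ := (Tens.exact_map_left (P.exact n) (P.surjective_p n) _).1 hz'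
  rw [← Tens.map_comm] at hz
  rw [← hY n hz, (Tens.exact_map_right hfg hg).apply_apply_eq_zero]

end TorSequences

/-! ### Dualizing a free resolution into the bimodule -/

section Dual

variable {A B C : Type u} [Ring A] [Ring B] [AddCommGroup C] [Module A C] [Module B C]
  [SMulCommClass A B C] {K K' K'' : Type u} [AddCommGroup K] [Module A K] [AddCommGroup K']
  [Module A K'] [AddCommGroup K''] [Module A K'']

variable (B C) in
/-- The map `Hom_A(φ, C)`, linear over a ring `B` acting on `C`. -/
def precomp (φ : K →ₗ[A] K') : (K' →ₗ[A] C) →ₗ[B] (K →ₗ[A] C) where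
  toFun f := f ∘ₗ φ
  map_add' _ _ := rfl
  map_smul' _ _ := rfl

@[simp]
lemma precomp_apply (φ : K →ₗ[A] K') (f : K' →ₗ[A] C) : precomp B C φ f = f ∘ₗ φ := rfl

/-- Evaluation at an element, linear over a ring `B` acting on `C`. -/
def evalAt (k : K) : (K →ₗ[A] C) →ₗ[B] C where
  toFun f := f k
  map_add' _ _ := rfl
  map_smul' _ _ := rfl

lemma precomp_injective {φ : K →ₗ[A] K'} (h : Function.Surjective φ) :
    Function.Injective (precomp B C φ) := fun _ _ hfg =>
  (LinearMap.cancel_right h).1 hfg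

lemma precomp_exact {i : K →ₗ[A] K'} {p : K' →ₗ[A] K''} (hp : Function.Surjective p)
    (he : Function.Exact i p) : Function.Exact (precomp B C p) (precomp B C i) := by
  intro f
  constructor
  · intro hf
    obtain ⟨g, hg⟩ := exists_desc_of_exact hp he f hf
    exact ⟨g, hg⟩
  · rintro ⟨g, rfl⟩
    rw [precomp_apply, precomp_apply, LinearMap.comp_assoc, he.linearMap_comp_eq_zero,
      LinearMap.comp_zero]

lemma FreeRes.precomp_i_surjective (P : FreeRes A K) (h : ExtVanishes A K C) (n : ℕ) :
    Function.Surjective (precomp B C (P.i n)) := by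
  rw [P.extVanishes_iff] at h
  exact h n

/-- The modules `Hom_A(K_n, C)` for the syzygies `K_n` of `C` inherit resolutions by finitely
generated free modules. -/
lemma FreeRes.fpInf_dual (P : FreeRes A C) (h : ExtVanishes A C C) (hC : FPInf B C)
    (hE : FPInf B (C →ₗ[A] C)) (n : ℕ) : FPInf B (P.K n →ₗ[A] C) := by
  induction n with
  | zero =>
    refine hE.of_equiv (LinearEquiv.ofBijective (precomp B C P.e.toLinearMap)
      ⟨precomp_injective P.e.surjective, fun f => ⟨f ∘ₗ P.e.symm.toLinearMap, ?_⟩⟩)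
    ext x
    simp
  | succ n ih =>
    -- Vanishing of `Ext(C, C)` makes `0 → Hom(K_n, C) → C ^ r → Hom(K_{n+1}, C) → 0` exact, so the
    -- next dual is a cokernel of modules already treated.
    refine FPInf.cokernel ih ?_ (precomp B C (P.p n)) (precomp B C (P.i n))
      (precomp_injective (P.surjective_p n)) (P.precomp_i_surjective h n)
      (precomp_exact (P.surjective_p n) (P.exact n))
    exact (hC.finPow (P.rk n)).of_equiv (LinearEquiv.piRing A C (Fin (P.rk n)) B).symm

end Dual

end

noncomputable section

variable {R S C : Type u} [Ring R] [Ring S] [AddCommGroup C] [Module S C] [Module Rᵐᵒᵖ C]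
  [SMulCommClass S Rᵐᵒᵖ C]

/-! ### Tensor evaluation -/

section TensorEvaluation

variable {K K' Y : Type u} [AddCommGroup K] [Module S K] [AddCommGroup K'] [Module S K']
  [AddCommGroup Y] [Module R Y]

variable (R S C K Y) in
/-- The map `Hom_S(K, C) ⊗_R Y → Hom_S(K, C ⊗_R Y)`, `f ⊗ y ↦ (k ↦ f(k) ⊗ y)`. -/
def tensorEval : Tens R (K →ₗ[S] C) Y →+ (K →ₗ[S] Tens R C Y) :=
  Tens.lift R
    (AddMonoidHom.mk' (fun f => AddMonoidHom.mk'
        (fun y => LinearMap.comp (mu R S C Y y : C →ₗ[S] Tens R C Y) f)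
        (fun y y' => by ext k; exact Tens.tmul_add R (f k) y y'))
      (fun f f' => by ext y k; exact Tens.add_tmul R (f k) (f' k) y))
    (fun f r y => by ext k; exact Tens.smul_tmul R (f k) r y)

lemma tensorEval_precomp (φ : K →ₗ[S] K') (t : Tens R (K' →ₗ[S] C) Y) :
    tensorEval R S C K Y (Tens.map R (precomp Rᵐᵒᵖ C φ) LinearMap.id t) =
      tensorEval R S C K' Y t ∘ₗ φ := by
  induction t using Tens.induction_on with
  | tmul f y => rfl
  | add x y hx hy => rw [map_add, map_add, map_add, hx, hy, LinearMap.add_comp]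

lemma tensorEval_apply (t : Tens R (K →ₗ[S] C) Y) (k : K) :
    tensorEval R S C K Y t k = Tens.map R (evalAt k) LinearMap.id t := by
  induction t using Tens.induction_on with
  | tmul f y => rfl
  | add x y hx hy => rw [map_add, map_add, LinearMap.add_apply, hx, hy]

/-- The maps `ι j` and the evaluations at the standard basis decompose `Hom_S(S^r, C)` as `C^r`.
Tensoring with `Y` preserves the decomposition, and evaluation becomes the identity of `(C ⊗ Y)^r`.
-/
lemma tensorEval_bijective_of_free (r : ℕ) :
    Function.Bijective (tensorEval R S C (Fin r → S) Y) := by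
  let ι : Fin r → C →ₗ[Rᵐᵒᵖ] ((Fin r → S) →ₗ[S] C) := fun j =>
    (LinearEquiv.piRing S C (Fin r) Rᵐᵒᵖ).symm.toLinearMap ∘ₗ LinearMap.single Rᵐᵒᵖ (fun _ => C) j
  have hι : ∀ j l, evalAt (Pi.single l 1) ∘ₗ ι j =
      if j = l then LinearMap.id else (0 : C →ₗ[Rᵐᵒᵖ] C) := by
    intro j l
    ext c
    have : ι j c (Pi.single l 1) = (Pi.single j c : Fin r → C) l :=
      congrFun ((LinearEquiv.piRing S C (Fin r) Rᵐᵒᵖ).apply_symm_apply (Pi.single j c)) l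
    change ι j c (Pi.single l 1) = _
    rw [this]
    by_cases h : j = l
    · subst h
      simp
    · rw [Pi.single_eq_of_ne (Ne.symm h), if_neg h]
      rfl
  have hsum : ∑ j, ι j ∘ₗ evalAt (Pi.single j 1) = LinearMap.id := by
    refine LinearMap.ext fun f => (LinearEquiv.piRing S C (Fin r) Rᵐᵒᵖ).injective ?_
    ext l
    have h : ∀ j, (ι j ∘ₗ evalAt (Pi.single j 1)) f (Pi.single l 1) =
        if j = l then f (Pi.single l 1) else 0 := by
      intro j
      have := LinearMap.congr_fun (hι j l) (f (Pi.single j 1))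
      change evalAt (B := Rᵐᵒᵖ) (Pi.single l 1) (ι j (f (Pi.single j 1))) = _
      refine this.trans ?_
      split_ifs with h
      · subst h; rfl
      · rfl
    simp only [LinearEquiv.piRing_apply, LinearMap.sum_apply, LinearMap.id_apply]
    simp_rw [h]
    simp
  constructor
  · refine (injective_iff_map_eq_zero _).2 fun t ht => ?_
    rw [← Tens.map_id_apply t, ← hsum, Tens.map_sum_left]
    refine Finset.sum_eq_zero fun j _ => ?_
    rw [← Tens.map_map_left, ← tensorEval_apply, ht, LinearMap.zero_apply, map_zero]
  · intro g
    refine ⟨∑ j, Tens.map R (ι j) LinearMap.id (g (Pi.single j 1)), ?_⟩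
    apply (LinearEquiv.piRing S (Tens R C Y) (Fin r) ℤ).injective
    ext l
    simp only [LinearEquiv.piRing_apply, map_sum, LinearMap.sum_apply]
    simp_rw [tensorEval_apply, Tens.map_map_left, hι]
    rw [Finset.sum_eq_single l]
    · rw [if_pos rfl, Tens.map_id_apply]
    · intro j _ hj
      rw [if_neg hj, Tens.map_zero_left]
    · simp

/-- A five lemma chase against the free case: `hP` and `hY` say that the dualized sequences stay
exact after tensoring with `Y`. Injectivity is proved for all syzygies beforehand, since
surjectivity at `n` uses injectivity at `n + 1`. -/
lemma FreeRes.tensorEval_bijective (P : FreeRes S C)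
    (hP : ∀ n, Function.Surjective (precomp Rᵐᵒᵖ C (P.i n)))
    (hY : ∀ n, Function.Injective
      (Tens.map R (precomp Rᵐᵒᵖ C (P.p n)) (LinearMap.id : Y →ₗ[R] Y)))
    (n : ℕ) :
    Function.Bijective (tensorEval R S C (P.K n) Y) := by
  have hinj : ∀ n, Function.Injective (tensorEval R S C (P.K n) Y) := by
    intro n
    refine (injective_iff_map_eq_zero _).2 fun t ht => hY n ?_
    apply (tensorEval_bijective_of_free (P.rk n)).1
    rw [tensorEval_precomp, ht, LinearMap.zero_comp, map_zero, map_zero]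
  refine ⟨hinj n, fun g => ?_⟩
  obtain ⟨z, hz⟩ := (tensorEval_bijective_of_free (P.rk n)).2 (g ∘ₗ P.p n)
  have hz' : Tens.map R (precomp Rᵐᵒᵖ C (P.i n)) LinearMap.id z = 0 := by
    apply hinj
    rw [tensorEval_precomp, hz, LinearMap.comp_assoc, (P.exact n).linearMap_comp_eq_zero,
      LinearMap.comp_zero, map_zero]
  obtain ⟨w, rfl⟩ := (Tens.exact_map_left
    (precomp_exact (P.surjective_p n) (P.exact n)) (hP n) _).1 hz'
  rw [tensorEval_precomp] at hz
  exact ⟨w, (LinearMap.cancel_right (P.surjective_p n)).1 hz⟩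

/-- A map `K_{n+1} → C ⊗ Y` is the evaluation of a tensor in `Hom(K_{n+1}, C) ⊗ Y`. This lifts to
`Hom(F_n, C) ⊗ Y`, and evaluating the lift extends the map to `F_n`. -/
lemma FreeRes.extVanishes_tens (P : FreeRes S C)
    (hP : ∀ n, Function.Surjective (precomp Rᵐᵒᵖ C (P.i n)))
    (hY : ∀ n, Function.Injective
      (Tens.map R (precomp Rᵐᵒᵖ C (P.p n)) (LinearMap.id : Y →ₗ[R] Y))) :
    ExtVanishes S C (Tens R C Y) := by
  rw [P.extVanishes_iff]
  intro n f
  obtain ⟨t, rfl⟩ := (P.tensorEval_bijective hP hY (n + 1)).2 f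
  obtain ⟨z, rfl⟩ := Tens.map_surjective (hP n) (g := (LinearMap.id : Y →ₗ[R] Y))
    Function.surjective_id t
  exact ⟨tensorEval R S C _ Y z, (tensorEval_precomp _ _).symm⟩

lemma tensorEval_bijective_of_equiv (e : K ≃ₗ[S] K')
    (h : Function.Bijective (tensorEval R S C K Y)) :
    Function.Bijective (tensorEval R S C K' Y) := by
  let e' : (K' →ₗ[S] C) ≃ₗ[Rᵐᵒᵖ] (K →ₗ[S] C) := LinearEquiv.ofBijective
    (precomp Rᵐᵒᵖ C e.toLinearMap)
    ⟨precomp_injective e.surjective, fun f => ⟨f ∘ₗ e.symm.toLinearMap, by ext x; simp⟩⟩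
  have he' := Tens.map_bijective e' (LinearEquiv.refl R Y)
  have key : ∀ t, tensorEval R S C K Y (Tens.map R e'.toLinearMap
      (LinearEquiv.refl R Y).toLinearMap t) = tensorEval R S C K' Y t ∘ₗ e.toLinearMap :=
    fun t => tensorEval_precomp e.toLinearMap t
  constructor
  · refine (injective_iff_map_eq_zero _).2 fun t ht => ?_
    apply he'.1
    apply h.1
    rw [key, ht, map_zero, map_zero, LinearMap.zero_comp]
  · intro g
    obtain ⟨t, ht⟩ := h.2 (g ∘ₗ e.toLinearMap)
    obtain ⟨t, rfl⟩ := he'.2 t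
    rw [key] at ht
    exact ⟨t, (LinearMap.cancel_right e.surjective).1 ht⟩

lemma Tens.one_tmul_bijective :
    Function.Bijective (fun y : Y => Tens.tmul R (1 : Rᵐᵒᵖ) y) := by
  let φ : Tens R Rᵐᵒᵖ Y →+ Y := Tens.lift R
    (AddMonoidHom.mk' (fun c => AddMonoidHom.mk' (fun y => unop c • y)
      (fun y y' => smul_add _ y y')) (fun c c' => by ext m; simp [add_smul]))
    (fun c r m => by simp [mul_smul])
  refine Function.bijective_iff_has_inverse.2 ⟨φ, fun y => ?_, fun t => ?_⟩
  · exact one_smul R y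
  · have h : ∀ t, Tens.tmul R (1 : Rᵐᵒᵖ) (φ t) = t := by
      intro t
      induction t using Tens.induction_on with
      | tmul c m =>
        change Tens.tmul R (1 : Rᵐᵒᵖ) (unop c • m) = _
        rw [← Tens.smul_tmul, op_unop, smul_eq_mul, mul_one]
      | add x y hx hy => rw [map_add, Tens.tmul_add, hx, hy]
    exact h t

variable (R S C) in
/-- The homothety `R^op → Hom_S(C, C)` as a map of right `R`-modules. -/
def homothetyRight : Rᵐᵒᵖ →ₗ[Rᵐᵒᵖ] (C →ₗ[S] C) where
  toFun b := rightMul S C (unop b)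
  map_add' b b' := by ext c; exact add_smul b b' c
  map_smul' b b' := by ext c; exact mul_smul b b' c

/-- `μ_Y` is the composite `Y ≅ R ⊗ Y ≅ Hom_S(C, C) ⊗ Y → Hom_S(C, C ⊗ Y)`. -/
lemma mu_bijective_of_tensorEval
    (hR : Function.Bijective fun r : R => rightMul S C r)
    (h : Function.Bijective (tensorEval R S C C Y)) : Function.Bijective (mu R S C Y) := by
  let e := LinearEquiv.ofBijective (homothetyRight R S C) (hR.comp unop_bijective)
  have he := Tens.map_bijective e (LinearEquiv.refl R Y)
  have : (mu R S C Y : Y → HomS S C (Tens R C Y)) = (tensorEval R S C C Y) ∘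
      (Tens.map R e.toLinearMap (LinearEquiv.refl R Y).toLinearMap) ∘
        (fun y : Y => Tens.tmul R (1 : Rᵐᵒᵖ) y) := by
    funext y
    refine HomS.ext fun c => ?_
    rw [mu_apply]
    change _ = Tens.tmul R ((op (unop 1) : Rᵐᵒᵖ) • c) y
    rw [op_unop, one_smul]
  rw [this]
  exact h.comp (he.comp Tens.one_tmul_bijective)

end TensorEvaluation

/-! ### Hom evaluation -/

section HomEvaluation

variable [SMulCommClass Rᵐᵒᵖ S C]
  {K K' X : Type u} [AddCommGroup K] [Module Rᵐᵒᵖ K] [AddCommGroup K'] [Module Rᵐᵒᵖ K']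
  [AddCommGroup X] [Module S X]

variable (R S C K X) in
/-- The map `K ⊗_R Hom_S(C, X) → Hom_S(Hom_{R^op}(K, C), X)`, `k ⊗ f ↦ (φ ↦ f(φ(k)))`. -/
def homEval : Tens R K (HomS S C X) →+ ((K →ₗ[Rᵐᵒᵖ] C) →ₗ[S] X) :=
  Tens.lift R
    (AddMonoidHom.mk' (fun k => AddMonoidHom.mk'
        (fun f : HomS S C X => LinearMap.comp (f : C →ₗ[S] X)
          (evalAt k : (K →ₗ[Rᵐᵒᵖ] C) →ₗ[S] C))
        (fun f f' => rfl))
      (fun k k' => by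
        ext f φ
        change f (φ (k + k')) = f (φ k) + f (φ k')
        rw [map_add, map_add]))
    (fun k r f => by
      ext φ
      change f (φ (op r • k)) = f (op r • φ k)
      rw [map_smul])

lemma homEval_tmul (k : K) (f : HomS S C X) (φ : K →ₗ[Rᵐᵒᵖ] C) :
    homEval R S C K X (Tens.tmul R k f) φ = f (φ k) := rfl

lemma homEval_map (ψ : K →ₗ[Rᵐᵒᵖ] K') (t : Tens R K (HomS S C X)) :
    homEval R S C K' X (Tens.map R ψ LinearMap.id t) =
      homEval R S C K X t ∘ₗ precomp S C ψ := by
  induction t using Tens.induction_on with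
  | tmul f y => rfl
  | add x y hx hy => rw [map_add, map_add, map_add, hx, hy, LinearMap.add_comp]

/-- Both sides are `Hom_S(C, X)^r`, because `Hom_{R^op}(R^r, C) = C^r`. -/
lemma homEval_bijective_of_free (r : ℕ) :
    Function.Bijective (homEval R S C (Fin r → Rᵐᵒᵖ) X) := by
  let ι : Fin r → C →ₗ[S] ((Fin r → Rᵐᵒᵖ) →ₗ[Rᵐᵒᵖ] C) := fun j =>
    (LinearEquiv.piRing Rᵐᵒᵖ C (Fin r) S).symm.toLinearMap ∘ₗ LinearMap.single S (fun _ => C) j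
  have hι : ∀ j l c, ι j c (Pi.single l 1) = if j = l then c else 0 := by
    intro j l c
    have : ι j c (Pi.single l 1) = (Pi.single j c : Fin r → C) l :=
      congrFun ((LinearEquiv.piRing Rᵐᵒᵖ C (Fin r) S).apply_symm_apply (Pi.single j c)) l
    rw [this]
    by_cases h : j = l
    · subst h
      simp
    · rw [Pi.single_eq_of_ne (Ne.symm h), if_neg h]
  have hsum : ∀ φ : (Fin r → Rᵐᵒᵖ) →ₗ[Rᵐᵒᵖ] C, ∑ j, ι j (φ (Pi.single j 1)) = φ := by
    intro φ
    apply (LinearEquiv.piRing Rᵐᵒᵖ C (Fin r) S).injective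
    ext l
    simp only [LinearEquiv.piRing_apply, LinearMap.sum_apply]
    simp_rw [hι]
    simp
  constructor
  · refine (injective_iff_map_eq_zero _).2 fun t ht => ?_
    rw [← Tens.sum_single_coord t]
    refine Finset.sum_eq_zero fun j _ => ?_
    have h : Tens.coord (HomS S C X) j t = 0 := by
      refine HomS.ext fun c => ?_
      -- Testing on `ι j c` isolates the value at `c` of the `j`-th coordinate.
      have := LinearMap.congr_fun ht (ι j c)
      rw [← Tens.sum_single_coord t, map_sum, LinearMap.sum_apply] at this
      simp_rw [homEval_tmul, hι] at this
      rw [Finset.sum_eq_single j] at this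
      · simpa using this
      · intro l _ hl
        rw [if_neg hl.symm]
        exact map_zero (Tens.coord (HomS S C X) l t)
      · simp
    rw [h, Tens.tmul_zero]
  · intro g
    refine ⟨∑ j, Tens.tmul R (Pi.single j (1 : Rᵐᵒᵖ)) (g ∘ₗ ι j : C →ₗ[S] X), ?_⟩
    ext φ
    rw [map_sum, LinearMap.sum_apply]
    conv_rhs => rw [← hsum φ, map_sum]
    rfl

/-- Dual to `FreeRes.tensorEval_bijective`: `hX` extends maps to the dual of the free module and
gives surjectivity for all syzygies, and injectivity at `n` then uses surjectivity at `n + 1`. -/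
lemma FreeRes.homEval_bijective (P : FreeRes Rᵐᵒᵖ C)
    (hP : ∀ n, Function.Surjective (precomp S C (P.i n)))
    (hX : ∀ n, ∀ f : (P.K n →ₗ[Rᵐᵒᵖ] C) →ₗ[S] X,
      ∃ g : ((Fin (P.rk n) → Rᵐᵒᵖ) →ₗ[Rᵐᵒᵖ] C) →ₗ[S] X, g ∘ₗ precomp S C (P.p n) = f)
    (n : ℕ) :
    Function.Bijective (homEval R S C (P.K n) X) := by
  have hsurj : ∀ n, Function.Surjective (homEval R S C (P.K n) X) := by
    intro n f
    obtain ⟨g, rfl⟩ := hX n f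
    obtain ⟨t, rfl⟩ := (homEval_bijective_of_free (P.rk n)).2 g
    exact ⟨_, homEval_map (P.p n) t⟩
  refine ⟨(injective_iff_map_eq_zero _).2 fun t ht => ?_, hsurj n⟩
  obtain ⟨z, rfl⟩ := Tens.map_surjective (R := R) (P.surjective_p n)
    (g := (LinearMap.id : HomS S C X →ₗ[R] HomS S C X)) Function.surjective_id t
  rw [homEval_map] at ht
  obtain ⟨g, hg⟩ := exists_desc_of_exact (hP n)
    (precomp_exact (P.surjective_p n) (P.exact n)) _ ht
  obtain ⟨w, rfl⟩ := hsurj (n + 1) g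
  rw [← homEval_map] at hg
  rw [← (homEval_bijective_of_free (P.rk n)).1 hg,
    (Tens.exact_map_left (P.exact n) (P.surjective_p n)).apply_apply_eq_zero]

/-- Under Hom evaluation `i n ⊗ Hom_S(C, X)` becomes composition with the surjection `Hom(F_n, C) →
Hom(K_{n+1}, C)`, which is injective. -/
lemma FreeRes.torVanishes_homS (P : FreeRes Rᵐᵒᵖ C)
    (hP : ∀ n, Function.Surjective (precomp S C (P.i n)))
    (hX : ∀ n, ∀ f : (P.K n →ₗ[Rᵐᵒᵖ] C) →ₗ[S] X,
      ∃ g : ((Fin (P.rk n) → Rᵐᵒᵖ) →ₗ[Rᵐᵒᵖ] C) →ₗ[S] X, g ∘ₗ precomp S C (P.p n) = f) :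
    TorVanishes R C (HomS S C X) := by
  rw [P.torVanishes_iff]
  intro n
  refine (injective_iff_map_eq_zero _).2 fun t ht => ?_
  apply (P.homEval_bijective hP hX (n + 1)).1
  have := homEval_map (P.i n) t
  rw [ht, map_zero] at this
  rw [map_zero]
  exact (LinearMap.cancel_right (hP n)).1 (this.symm.trans (LinearMap.zero_comp _).symm)

lemma homEval_bijective_of_equiv (e : K ≃ₗ[Rᵐᵒᵖ] K')
    (h : Function.Bijective (homEval R S C K X)) :
    Function.Bijective (homEval R S C K' X) := by
  have he := Tens.map_bijective e (LinearEquiv.refl R (HomS S C X))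
  have hp : Function.Surjective (precomp S C e.toLinearMap) := fun f =>
    ⟨f ∘ₗ e.symm.toLinearMap, by ext x; simp⟩
  have key : ∀ t, homEval R S C K' X (Tens.map R e.toLinearMap
      (LinearEquiv.refl R (HomS S C X)).toLinearMap t) =
        homEval R S C K X t ∘ₗ precomp S C e.toLinearMap :=
    fun t => homEval_map e.toLinearMap t
  constructor
  · refine (injective_iff_map_eq_zero _).2 fun t ht => ?_
    obtain ⟨t, rfl⟩ := he.2 t
    rw [key] at ht
    have : homEval R S C K X t = 0 :=
      (LinearMap.cancel_right hp).1 (ht.trans (LinearMap.zero_comp _).symm)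
    rw [h.1 (this.trans (map_zero _).symm), map_zero]
  · intro g
    obtain ⟨t, ht⟩ := h.2 (g ∘ₗ precomp S C e.symm.toLinearMap)
    refine ⟨_, (key t).trans ?_⟩
    rw [ht]
    ext φ
    change g ((φ ∘ₗ e.toLinearMap) ∘ₗ e.symm.toLinearMap) = g φ
    congr 1
    ext x
    simp

variable (R S C) in
/-- The homothety `S → Hom_{R^op}(C, C)` as a map of left `S`-modules. -/
def homothetyLeft : S →ₗ[S] (C →ₗ[Rᵐᵒᵖ] C) where
  toFun s := Module.toModuleEnd Rᵐᵒᵖ C s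
  map_add' b b' := by ext c; exact add_smul b b' c
  map_smul' b b' := by ext c; exact mul_smul b b' c

/-- `ν_X` is Hom evaluation followed by evaluation at the identity of `C`. The latter is bijective
since the identity corresponds to `1` under `S ≅ Hom_{R^op}(C, C)`. -/
lemma nu_bijective_of_homEval
    (hS : Function.Bijective fun s : S => Module.toModuleEnd Rᵐᵒᵖ C s)
    (h : Function.Bijective (homEval R S C C X)) : Function.Bijective (nu R S C X) := by
  let e : S ≃ₗ[S] (C →ₗ[Rᵐᵒᵖ] C) := LinearEquiv.ofBijective (homothetyLeft R S C) hS
  have he1 : e 1 = LinearMap.id := by ext c; exact one_smul S c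
  have hev : Function.Bijective fun g : (C →ₗ[Rᵐᵒᵖ] C) →ₗ[S] X => g LinearMap.id := by
    constructor
    · intro g g' hgg
      have : g ∘ₗ e.toLinearMap = g' ∘ₗ e.toLinearMap := by
        ext
        simpa [he1] using hgg
      exact (LinearMap.cancel_right e.surjective).1 this
    · intro x
      refine ⟨LinearMap.toSpanSingleton S X x ∘ₗ e.symm.toLinearMap, ?_⟩
      simp [← he1]
  have : (nu R S C X : Tens R C (HomS S C X) → X) =
      (fun g : (C →ₗ[Rᵐᵒᵖ] C) →ₗ[S] X => g LinearMap.id) ∘ homEval R S C C X := by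
    funext t
    induction t using Tens.induction_on with
    | tmul c f => rfl
    | add x y hx hy =>
      simp only [Function.comp_apply, map_add, LinearMap.add_apply] at hx hy ⊢
      rw [hx, hy]
  rw [this]
  exact hev.comp h

end HomEvaluation

end

noncomputable section

/-! ### Short exact sequences under the two functors -/

section Sequences

variable {A : Type u} [Ring A] {X Y Z X' Y' Z' : Type u} [AddCommGroup X] [Module A X]
  [AddCommGroup Y] [Module A Y] [AddCommGroup Z] [Module A Z] [AddCommGroup X'] [Module A X']
  [AddCommGroup Y'] [Module A Y'] [AddCommGroup Z'] [Module A Z']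
  {f : X →ₗ[A] Y} {g : Y →ₗ[A] Z} {f' : X' →ₗ[A] Y'} {g' : Y' →ₗ[A] Z'}
  {a : X →ₗ[A] X'} {b : Y →ₗ[A] Y'} {c : Z →ₗ[A] Z'}

lemma bijective_left_of_bijective (hf : Function.Injective f) (hfg : Function.Exact f g)
    (hf' : Function.Injective f') (hfg' : Function.Exact f' g')
    (hab : ∀ x, f' (a x) = b (f x)) (hbc : ∀ y, g' (b y) = c (g y))
    (hb : Function.Bijective b) (hc : Function.Bijective c) : Function.Bijective a := by
  constructor
  · refine (injective_iff_map_eq_zero _).2 fun x hx => ?_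
    apply hf
    apply hb.1
    rw [← hab, hx, map_zero, map_zero, map_zero]
  · intro x'
    obtain ⟨y, hy⟩ := hb.2 (f' x')
    obtain ⟨x, rfl⟩ := (hfg y).1 (hc.1 (by
      rw [← hbc, hy, hfg'.apply_apply_eq_zero, map_zero]))
    exact ⟨x, hf' (by rw [hab, hy])⟩

lemma bijective_right_of_bijective (hg : Function.Surjective g) (hfg : Function.Exact f g)
    (hg' : Function.Surjective g') (hfg' : Function.Exact f' g')
    (hab : ∀ x, f' (a x) = b (f x)) (hbc : ∀ y, g' (b y) = c (g y))
    (ha : Function.Bijective a) (hb : Function.Bijective b) : Function.Bijective c := by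
  constructor
  · refine (injective_iff_map_eq_zero _).2 fun z hz => ?_
    obtain ⟨y, rfl⟩ := hg z
    rw [← hbc] at hz
    obtain ⟨x', hx'⟩ := (hfg' _).1 hz
    obtain ⟨x, rfl⟩ := ha.2 x'
    rw [hab] at hx'
    rw [← hb.1 hx', hfg.apply_apply_eq_zero]
  · intro z'
    obtain ⟨y', rfl⟩ := hg' z'
    obtain ⟨y, rfl⟩ := hb.2 y'
    exact ⟨g y, (hbc y).symm⟩

end Sequences

variable {R S C : Type u} [Ring R] [Ring S] [AddCommGroup C] [Module S C] [Module Rᵐᵒᵖ C]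
  [SMulCommClass S Rᵐᵒᵖ C]

section Functors

variable {X Y Z : Type u} [AddCommGroup X] [AddCommGroup Y] [AddCommGroup Z]

lemma tensorMap_exact [Module R X] [Module R Y] [Module R Z] {f : X →ₗ[R] Y} {g : Y →ₗ[R] Z}
    (hg : Function.Surjective g) (hfg : Function.Exact f g) :
    Function.Exact (tensorMap R S C f) (tensorMap R S C g) :=
  Tens.exact_map_right hfg hg

lemma tensorMap_surjective [Module R X] [Module R Y] {f : X →ₗ[R] Y}
    (hf : Function.Surjective f) : Function.Surjective (tensorMap R S C f) :=
  Tens.map_surjective Function.surjective_id hf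

lemma homMap_injective [Module S X] [Module S Y] {f : X →ₗ[S] Y}
    (hf : Function.Injective f) : Function.Injective (homMap R S C f) := fun _ _ h =>
  (LinearMap.cancel_left hf).1 h

lemma homMap_exact [Module S X] [Module S Y] [Module S Z] {f : X →ₗ[S] Y} {g : Y →ₗ[S] Z}
    (hf : Function.Injective f) (hfg : Function.Exact f g) :
    Function.Exact (homMap R S C f) (homMap R S C g) := by
  intro h
  constructor
  · intro hh
    obtain ⟨k, hk⟩ := exists_lift_of_exact hf hfg (h : C →ₗ[S] Y) hh
    exact ⟨k, hk⟩
  · rintro ⟨k, rfl⟩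
    exact HomS.ext fun c => hfg.apply_apply_eq_zero (k c)

lemma nu_tensorMap_homMap [Module S X] [Module S Y] (g : X →ₗ[S] Y) (t : Tens R C (HomS S C X)) :
    nu R S C Y (tensorMap R S C (homMap R S C g) t) = g (nu R S C X t) := by
  induction t using Tens.induction_on with
  | tmul c f => rfl
  | add x y hx hy => rw [map_add, map_add, map_add, map_add, hx, hy]

lemma homMap_tensorMap_mu [Module R X] [Module R Y] (g : X →ₗ[R] Y) (x : X) :
    homMap R S C (tensorMap R S C g) (mu R S C X x) = mu R S C Y (g x) := rfl

/-- One triangle identity; `homMap_nu_mu` is the other. -/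
lemma nu_tensorMap_mu [Module R X] (t : Tens R C X) :
    nu R S C (Tens R C X) (tensorMap R S C (mu R S C X) t) = t := by
  induction t using Tens.induction_on with
  | tmul c f => rfl
  | add x y hx hy => rw [map_add, map_add, hx, hy]

lemma homMap_nu_mu [Module S X] (h : HomS S C X) :
    homMap R S C (nu R S C X) (mu R S C (HomS S C X) h) = h := rfl

variable (S C) in
/-- `C ⊗_R -` applied to an isomorphism. -/
def tensorEquiv [Module R X] [Module R Y] (e : X ≃ₗ[R] Y) : Tens R C X ≃ₗ[S] Tens R C Y :=
  LinearEquiv.ofBijective (tensorMap R S C e.toLinearMap)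
    (Tens.map_bijective (LinearEquiv.refl Rᵐᵒᵖ C) e)

variable (R C) in
/-- `Hom_S(C, -)` applied to an isomorphism. -/
def homEquiv [Module S X] [Module S Y] (e : X ≃ₗ[S] Y) : HomS S C X ≃ₗ[R] HomS S C Y :=
  LinearEquiv.ofBijective (homMap R S C e.toLinearMap) ⟨homMap_injective e.injective, fun f =>
    ⟨LinearMap.comp e.symm.toLinearMap (f : C →ₗ[S] Y),
      HomS.ext fun c => e.apply_symm_apply (f c)⟩⟩

end Functors

/-! ### The Auslander and Bass classes -/

section Classes

lemma auslander_of_equiv (hC : IsSemidualizing R S C) {M M' : ModuleCat.{u} R}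
    (e : M ≃ₗ[R] M') (h : auslander R S C M) : auslander R S C M' := by
  obtain ⟨h1, h2, h3⟩ := h
  refine ⟨h1.of_equiv e hC.finite_right.fpInf, h2.of_equiv_right (tensorEquiv S C e), ?_⟩
  have : (mu R S C M' : M' → _) =
      homEquiv R C (tensorEquiv S C e) ∘ mu R S C M ∘ e.symm := by
    funext m
    obtain ⟨m, rfl⟩ := e.surjective m
    simp only [Function.comp_apply, LinearEquiv.symm_apply_apply]
    exact (homMap_tensorMap_mu e.toLinearMap m).symm
  rw [this]
  exact (LinearEquiv.bijective _).comp (h3.comp e.symm.bijective)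

lemma bass_of_equiv (hC : IsSemidualizing R S C) {N N' : ModuleCat.{u} S}
    (e : N ≃ₗ[S] N') (h : bass R S C N) : bass R S C N' := by
  obtain ⟨h1, h2, h3⟩ := h
  refine ⟨h1.of_equiv_right e, h2.of_equiv (homEquiv R C e) hC.finite_right.fpInf, ?_⟩
  have : (nu R S C N' : _ → N') ∘ tensorEquiv S C (homEquiv R C e) = e ∘ nu R S C N := by
    funext t
    exact nu_tensorMap_homMap e.toLinearMap t
  refine (Function.Bijective.of_comp_iff _
    (tensorEquiv S C (homEquiv R C e)).bijective).1 ?_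
  rw [this]
  exact e.bijective.comp h3

/-- The Tor condition moves along `M ≅ Hom_S(C, C ⊗ M)`, and `ν` at `C ⊗ M` is a one-sided inverse
of the isomorphism `C ⊗ μ_M`. -/
lemma bass_tensor (hC : IsSemidualizing R S C) {M : ModuleCat.{u} R}
    (h : auslander R S C M) : bass R S C ((tensorFunctor R S C).obj M) := by
  obtain ⟨h1, h2, h3⟩ := h
  let e : M ≃ₗ[R] HomS S C (Tens R C M) := LinearEquiv.ofBijective _ h3
  refine ⟨h2, h1.of_equiv e hC.finite_right.fpInf, ?_⟩
  refine (Function.Bijective.of_comp_iff _ (tensorEquiv S C e).bijective).1 ?_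
  have : nu R S C (Tens R C M) ∘ tensorEquiv S C e = id := funext nu_tensorMap_mu
  exact this ▸ Function.bijective_id

lemma auslander_hom {N : ModuleCat.{u} S}
    (h : bass R S C N) : auslander R S C ((homFunctor R S C).obj N) := by
  obtain ⟨h1, h2, h3⟩ := h
  let e : Tens R C (HomS S C N) ≃ₗ[S] N := LinearEquiv.ofBijective _ h3
  refine ⟨h2, h1.of_equiv_right e.symm, ?_⟩
  refine (Function.Bijective.of_comp_iff' (homEquiv R C e).bijective _).1 ?_
  have : homEquiv R C e ∘ mu R S C (HomS S C N) = id := funext homMap_nu_mu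
  exact this ▸ Function.bijective_id

/-! ### Faithfulness -/

/-- The character module `Hom_ℤ(E, ℚ/ℤ)` of a left module, as a right module. -/
def CharDual (E : Type u) [AddCommGroup E] : Type u := E →+ AddCircle (1 : ℚ)

instance (E : Type u) [AddCommGroup E] : AddCommGroup (CharDual E) :=
  inferInstanceAs (AddCommGroup (E →+ AddCircle (1 : ℚ)))

instance (E : Type u) [AddCommGroup E] : FunLike (CharDual E) E (AddCircle (1 : ℚ)) :=
  inferInstanceAs (FunLike (E →+ AddCircle (1 : ℚ)) E (AddCircle (1 : ℚ)))

instance (E : Type u) [AddCommGroup E] [Module R E] : Module Rᵐᵒᵖ (CharDual E) where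
  smul b φ := AddMonoidHom.comp φ (DistribSMul.toAddMonoidHom E (unop b))
  one_smul φ := AddMonoidHom.ext fun e => congrArg φ.toFun (one_smul R e)
  mul_smul b b' φ := AddMonoidHom.ext fun e =>
    congrArg φ.toFun (mul_smul (unop b') (unop b) e)
  smul_zero _ := rfl
  smul_add _ _ _ := rfl
  add_smul b b' φ := AddMonoidHom.ext fun e =>
    (congrArg φ.toFun (add_smul (unop b) (unop b') e)).trans (φ.map_add' _ _)
  zero_smul φ := AddMonoidHom.ext fun e =>
    (congrArg φ.toFun (zero_smul R e)).trans φ.map_zero'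

/-- If `Hom_{R^op}(C, -)` reflects zero modules, then so does `C ⊗_R -`. -/
lemma subsingleton_of_subsingleton_tens
    (hC : ∀ M : ModuleCat.{u} Rᵐᵒᵖ, Subsingleton (C →ₗ[Rᵐᵒᵖ] M) → Subsingleton M)
    (E : Type u) [AddCommGroup E] [Module R E] (h : Subsingleton (Tens R C E)) :
    Subsingleton E := by
  have h' : Subsingleton (CharDual E) := by
    refine hC (ModuleCat.of Rᵐᵒᵖ (CharDual E)) (subsingleton_of_forall_eq 0 fun φ => ?_)
    refine LinearMap.ext fun c => AddMonoidHom.ext fun e => ?_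
    -- Hom-tensor adjunction: `φ : C → E⁺` is a balanced pairing, so it factors through `C ⊗ E = 0`.
    -- The `ULift` only brings `ℚ/ℤ` into the universe of `Tens.lift`.
    let ψ : C →+ E →+ AddCircle (1 : ℚ) := φ.toAddMonoidHom
    let up : AddCircle (1 : ℚ) →+ ULift.{u} (AddCircle (1 : ℚ)) :=
      AddEquiv.ulift.symm.toAddMonoidHom
    let l : Tens R C E →+ ULift.{u} (AddCircle (1 : ℚ)) :=
      Tens.lift R (AddMonoidHom.mk' (fun c => up.comp (ψ c)) (fun c c' => by ext e; simp))
        (fun c r e => congrArg ULift.up (DFunLike.congr_fun (F := CharDual E)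
          (φ.map_smul (op r) c) e))
    have : l (Tens.tmul R c e) = l 0 := congrArg l (Subsingleton.elim _ _)
    rw [map_zero] at this
    exact congrArg ULift.down this
  refine subsingleton_of_forall_eq 0 fun e => ?_
  by_contra he
  obtain ⟨c, hc⟩ := CharacterModule.exists_character_apply_ne_zero_of_ne_zero he
  exact hc (DFunLike.congr_fun (F := CharDual E) (Subsingleton.elim (α := CharDual E) c 0) e)

/-! ### Closure properties of the Auslander and Bass classes -/

lemma auslander_cokernel (hC : IsFaithfullySemidualizing R S C) {X Y Z : ModuleCat.{u} R}
    {f : X →ₗ[R] Y} {g : Y →ₗ[R] Z} (hf : Function.Injective f) (hg : Function.Surjective g)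
    (hfg : Function.Exact f g) (hX : auslander R S C X) (hY : auslander R S C Y) :
    auslander R S C Z ∧ Function.Injective (tensorMap R S C f) := by
  have hinj : Function.Injective (tensorMap R S C f) := by
    rw [← LinearMap.ker_eq_bot, ← Submodule.subsingleton_iff_eq_bot]
    -- It suffices that every `φ : C → ker (C ⊗ f)` is zero. Bijectivity of `μ_X` writes `φ` as `c ↦
    -- c ⊗ x`; then `μ_Y (f x) = 0`, so `f x = 0` and `x = 0`.
    refine hC.faithful_left (ModuleCat.of S (LinearMap.ker (tensorMap R S C f)))
      (subsingleton_of_forall_eq 0 fun φ => ?_)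
    obtain ⟨x, hx⟩ := hX.2.2.2 ((LinearMap.ker (tensorMap R S C f)).subtype ∘ₗ φ)
    have hx' : ∀ c, Tens.tmul R c x = (φ c).1 := fun c => DFunLike.congr_fun hx c
    have h0 : f x = 0 := by
      apply hY.2.2.1
      rw [map_zero, ← homMap_tensorMap_mu, hx]
      exact HomS.ext fun c => (φ c).2
    obtain rfl : x = 0 := hf (by rw [h0, map_zero])
    refine LinearMap.ext fun c => Subtype.ext ?_
    rw [← hx', Tens.tmul_zero]
    rfl
  have hfR := hC.finite_right.fpInf
  have hex := tensorMap_exact (S := S) (C := C) hg hfg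
  have hsurj := tensorMap_surjective (S := S) (C := C) hg
  refine ⟨⟨TorVanishes.cokernel hfR hf hg hfg hX.1 hY.1 hinj,
    ExtVanishes.cokernel hinj hsurj hex hX.2.1 hY.2.1, ?_⟩, hinj⟩
  refine bijective_right_of_bijective hg hfg ?_ (homMap_exact (R := R) hinj hex)
    (homMap_tensorMap_mu f) (homMap_tensorMap_mu g) hX.2.2 hY.2.2
  -- `Hom_S(C, -)` keeps the tensored sequence right exact because `Ext^1_S(C, C ⊗ X) = 0`.
  exact ExtVanishes.exists_lift hinj hsurj hex hX.2.1

lemma auslander_kernel (hC : IsSemidualizing R S C) {X Y Z : ModuleCat.{u} R}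
    {f : X →ₗ[R] Y} {g : Y →ₗ[R] Z} (hf : Function.Injective f) (hg : Function.Surjective g)
    (hfg : Function.Exact f g) (hY : auslander R S C Y) (hZ : auslander R S C Z) :
    auslander R S C X ∧ Function.Injective (tensorMap R S C f) := by
  have hfR := hC.finite_right.fpInf
  have hinj : Function.Injective (tensorMap R S C f) :=
    TorVanishes.injective_map hfR hf hg hfg hZ.1
  have hex := tensorMap_exact (S := S) (C := C) hg hfg
  have hsurj := tensorMap_surjective (S := S) (C := C) hg
  refine ⟨⟨TorVanishes.kernel hfR hf hg hfg hY.1 hZ.1,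
    ExtVanishes.kernel hinj hsurj hex hY.2.1 hZ.2.1 fun h => ?_, ?_⟩, hinj⟩
  -- Every map `C → C ⊗ Z` is `μ_Z z`, and `μ_Y y` lifts it for any preimage `y` of `z`.
  · obtain ⟨z, rfl⟩ := hZ.2.2.2 h
    obtain ⟨y, rfl⟩ := hg z
    exact ⟨mu R S C Y y, homMap_tensorMap_mu g y⟩
  · exact bijective_left_of_bijective hf hfg (homMap_injective (R := R) hinj)
      (homMap_exact hinj hex) (homMap_tensorMap_mu f) (homMap_tensorMap_mu g) hY.2.2 hZ.2.2

lemma bass_cokernel (hC : IsSemidualizing R S C) {X Y Z : ModuleCat.{u} S}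
    {f : X →ₗ[S] Y} {g : Y →ₗ[S] Z} (hf : Function.Injective f) (hg : Function.Surjective g)
    (hfg : Function.Exact f g) (hX : bass R S C X) (hY : bass R S C Y) :
    bass R S C Z ∧ Function.Surjective (homMap R S C g) := by
  have hfR := hC.finite_right.fpInf
  have hsurj : Function.Surjective (homMap R S C g) :=
    ExtVanishes.exists_lift hf hg hfg hX.1
  have hinj := homMap_injective (R := R) (C := C) hf
  have hex := homMap_exact (R := R) (C := C) hf hfg
  refine ⟨⟨ExtVanishes.cokernel hf hg hfg hX.1 hY.1,
    TorVanishes.cokernel hfR hinj hsurj hex hX.2.1 hY.2.1 ?_, ?_⟩, hsurj⟩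
  -- `C ⊗ Hom(C, f)` is injective because `ν` identifies it with `f`.
  · intro t t' h
    apply hX.2.2.1
    apply hf
    rw [← nu_tensorMap_homMap, ← nu_tensorMap_homMap]
    exact congrArg (nu R S C Y) h
  · exact bijective_right_of_bijective (tensorMap_surjective hsurj) (tensorMap_exact hsurj hex)
      hg hfg (fun t => (nu_tensorMap_homMap f t).symm) (fun t => (nu_tensorMap_homMap g t).symm)
      hX.2.2 hY.2.2

lemma bass_kernel (hC : IsFaithfullySemidualizing R S C) {X Y Z : ModuleCat.{u} S}
    {f : X →ₗ[S] Y} {g : Y →ₗ[S] Z} (hf : Function.Injective f) (hg : Function.Surjective g)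
    (hfg : Function.Exact f g) (hY : bass R S C Y) (hZ : bass R S C Z) :
    bass R S C X ∧ Function.Surjective (homMap R S C g) := by
  have hfR := hC.finite_right.fpInf
  have hsurj : Function.Surjective (homMap R S C g) := by
    rw [← LinearMap.range_eq_top, ← Submodule.Quotient.subsingleton_iff]
    -- The cokernel `E` of `Hom(C, g)` satisfies `C ⊗ E = 0`, because `ν` identifies `C ⊗ Hom(C, g)`
    -- with the surjection `g`. Faithfulness then gives `E = 0`.
    refine subsingleton_of_subsingleton_tens hC.faithful_right _
      (subsingleton_of_forall_eq 0 fun t => ?_)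
    have hq := Submodule.mkQ_surjective (LinearMap.range (homMap R S C g))
    obtain ⟨t, rfl⟩ := tensorMap_surjective (S := S) (C := C) hq t
    obtain ⟨y, hy⟩ := hg (nu R S C Z t)
    obtain ⟨w, rfl⟩ := hY.2.2.2 y
    rw [← nu_tensorMap_homMap] at hy
    obtain rfl := hZ.2.2.1 hy
    exact (tensorMap_exact hq (LinearMap.exact_map_mkQ_range _)).apply_apply_eq_zero w
  have hinj := homMap_injective (R := R) (C := C) hf
  have hex := homMap_exact (R := R) (C := C) hf hfg
  refine ⟨⟨ExtVanishes.kernel hf hg hfg hY.1 hZ.1 hsurj,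
    TorVanishes.kernel hfR hinj hsurj hex hY.2.1 hZ.2.1, ?_⟩, hsurj⟩
  exact bijective_left_of_bijective
    (TorVanishes.injective_map hfR hinj hsurj hex hZ.2.1 :
      Function.Injective (tensorMap R S C (homMap R S C f))) (tensorMap_exact hsurj hex)
    hf hfg (fun t => (nu_tensorMap_homMap f t).symm) (fun t => (nu_tensorMap_homMap g t).symm)
    hY.2.2 hZ.2.2

/-! ### Flat and injective modules -/

lemma fpF_le_auslander (hC : IsSemidualizing R S C) (n : ℕ) :
    fpF R n ≤ auslander R S C := by
  intro Y hY
  obtain ⟨P⟩ := hC.finite_left.fpInf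
  have hfR := hC.finite_right.fpInf
  have hE : FPInf Rᵐᵒᵖ (C →ₗ[S] C) := FPInf.self.of_equiv
    (LinearEquiv.ofBijective (homothetyRight R S C) (hC.homothety_right.comp unop_bijective))
  have hP : ∀ m, Function.Surjective (precomp Rᵐᵒᵖ C (P.i m)) :=
    P.precomp_i_surjective hC.ext_left
  have hF : ∀ r, FPInf Rᵐᵒᵖ ((Fin r → S) →ₗ[S] C) := fun r =>
    (hfR.finPow r).of_equiv (LinearEquiv.piRing S C (Fin r) Rᵐᵒᵖ).symm
  -- The point where flatness is used: the dual of each free cover is a monomorphism of finitely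
  -- `n`-presented right modules.
  have hinj : ∀ m, Function.Injective
      (Tens.map R (precomp Rᵐᵒᵖ C (P.p m)) (LinearMap.id : Y →ₗ[R] Y)) := fun m =>
    hY (ModuleCat.of Rᵐᵒᵖ (P.K m →ₗ[S] C)) (ModuleCat.of Rᵐᵒᵖ ((Fin (P.rk m) → S) →ₗ[S] C))
      ((P.fpInf_dual hC.ext_left hfR hE m).finitelyNPresented n)
      ((hF _).finitelyNPresented n) _ (precomp_injective (P.surjective_p m))
  refine ⟨?_, P.extVanishes_tens hP hinj, mu_bijective_of_tensorEval hC.homothety_right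
    (tensorEval_bijective_of_equiv P.e (P.tensorEval_bijective hP hinj 0))⟩
  obtain ⟨Q⟩ := hfR
  rw [Q.torVanishes_iff]
  exact fun m => hY (Q.K (m + 1)) (ModuleCat.of Rᵐᵒᵖ (Fin (Q.rk m) → Rᵐᵒᵖ))
    (FPInf.finitelyNPresented ⟨Q.shift (m + 1)⟩ n) ((FPInf.pi _).finitelyNPresented n) _
    (Q.injective_i m)

lemma fpI_le_bass (hC : IsSemidualizing R S C) (n : ℕ) : fpI S n ≤ bass R S C := by
  intro X hX
  have : SMulCommClass Rᵐᵒᵖ S C := SMulCommClass.symm S Rᵐᵒᵖ C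
  obtain ⟨P⟩ := hC.finite_right.fpInf
  have hfS := hC.finite_left.fpInf
  have hE : FPInf S (C →ₗ[Rᵐᵒᵖ] C) := FPInf.self.of_equiv
    (LinearEquiv.ofBijective (homothetyLeft R S C) hC.homothety_left)
  have hP : ∀ m, Function.Surjective (precomp S C (P.i m)) :=
    P.precomp_i_surjective hC.ext_right
  have hF : ∀ r, FPInf S ((Fin r → Rᵐᵒᵖ) →ₗ[Rᵐᵒᵖ] C) := fun r =>
    (hfS.finPow r).of_equiv (LinearEquiv.piRing Rᵐᵒᵖ C (Fin r) S).symm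
  -- Injectivity of `X` is tested on the duals of the free covers in the resolution of `C` over
  -- `R^op`.
  have hext : ∀ m, ∀ f : (P.K m →ₗ[Rᵐᵒᵖ] C) →ₗ[S] X,
      ∃ g : ((Fin (P.rk m) → Rᵐᵒᵖ) →ₗ[Rᵐᵒᵖ] C) →ₗ[S] X, g ∘ₗ precomp S C (P.p m) = f := fun m =>
    hX (ModuleCat.of S (P.K m →ₗ[Rᵐᵒᵖ] C)) (ModuleCat.of S ((Fin (P.rk m) → Rᵐᵒᵖ) →ₗ[Rᵐᵒᵖ] C))
      ((P.fpInf_dual hC.ext_right hfS hE m).finitelyNPresented n)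
      ((hF _).finitelyNPresented n) _ (precomp_injective (P.surjective_p m))
  refine ⟨?_, P.torVanishes_homS hP hext, nu_bijective_of_homEval hC.homothety_left
    (homEval_bijective_of_equiv P.e (P.homEval_bijective hP hext 0))⟩
  obtain ⟨Q⟩ := hfS
  rw [Q.extVanishes_iff]
  exact fun m => hX (Q.K (m + 1)) (ModuleCat.of S (Fin (Q.rk m) → S))
    (FPInf.finitelyNPresented ⟨Q.shift (m + 1)⟩ n) ((FPInf.pi _).finitelyNPresented n) _
    (Q.injective_i m)

lemma fpF_of_equiv {n : ℕ} {Y Y' : ModuleCat.{u} R} (e : Y ≃ₗ[R] Y') (h : fpF R n Y) :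
    fpF R n Y' := by
  intro K L hK hL j hj
  refine (injective_iff_map_eq_zero _).2 fun t ht => ?_
  obtain ⟨t, rfl⟩ := (Tens.map_bijective (LinearEquiv.refl Rᵐᵒᵖ K) e).2 t
  have : Tens.map R j LinearMap.id t = 0 := by
    apply (Tens.map_bijective (LinearEquiv.refl Rᵐᵒᵖ L) e).1
    rw [map_zero, ← ht]
    exact (Tens.map_comm j e.toLinearMap t).symm
  rw [h K L hK hL j hj (this.trans (map_zero _).symm), map_zero]

lemma fpI_of_equiv {n : ℕ} {X X' : ModuleCat.{u} S} (e : X ≃ₗ[S] X') (h : fpI S n X) :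
    fpI S n X' := by
  intro K L hK hL j hj f
  obtain ⟨g, hg⟩ := h K L hK hL j hj (e.symm.toLinearMap ∘ₗ f)
  refine ⟨e.toLinearMap ∘ₗ g, ?_⟩
  rw [LinearMap.comp_assoc, hg]
  ext x
  simp

lemma Tens.subsingleton_right {K M : Type u} [AddCommGroup K] [Module Rᵐᵒᵖ K] [AddCommGroup M]
    [Module R M] [Subsingleton M] : Subsingleton (Tens R K M) := by
  refine subsingleton_of_forall_eq 0 fun t => ?_
  induction t using Tens.induction_on with
  | tmul c m => rw [Subsingleton.elim m 0, Tens.tmul_zero]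
  | add x y hx hy => rw [hx, hy, add_zero]

lemma fpF_of_subsingleton (n : ℕ) (Y : ModuleCat.{u} R) [Subsingleton Y] : fpF R n Y :=
  fun K _ _ _ _ _ =>
    have := Tens.subsingleton_right (R := R) (K := K) (M := Y)
    Function.injective_of_subsingleton _

lemma fpI_of_subsingleton (n : ℕ) (X : ModuleCat.{u} S) [Subsingleton X] : fpI S n X :=
  fun _ _ _ _ _ _ _ => ⟨0, LinearMap.ext fun _ => Subsingleton.elim _ _⟩

end Classes

end

noncomputable section

/-! ### Finite resolutions and coresolutions -/

section Dimension

variable {A : Type u} [Ring A] {P : ObjectProperty (ModuleCat.{u} A)}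

lemma resolDimLE_zero_iff {M : ModuleCat.{u} A} :
    resolDimLE P 0 M ↔ ∃ F : ModuleCat.{u} A, P F ∧ Nonempty (F ≃ₗ[A] M) := by
  constructor
  · rintro ⟨F, ε, d, hF, h1, hε, he, -⟩
    refine ⟨F 0, hF 0 le_rfl, ⟨LinearEquiv.ofBijective ε
      ⟨(injective_iff_map_eq_zero _).2 fun x hx => ?_, hε⟩⟩⟩
    obtain ⟨y, rfl⟩ := (he x).1 hx
    have := h1
    rw [Subsingleton.elim y 0, map_zero]
  · rintro ⟨F, hF, ⟨e⟩⟩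
    refine ⟨fun i => Nat.casesOn i F (fun _ => ModuleCat.of A PUnit), e.toLinearMap,
      fun _ => 0, ?_, ?_, e.surjective, ?_, fun i hi => absurd hi (Nat.not_lt_zero i)⟩
    · intro i hi
      obtain rfl := Nat.le_zero.1 hi
      exact hF
    · exact inferInstanceAs (Subsingleton PUnit)
    · intro x
      constructor
      · intro hx
        exact ⟨0, (e.map_eq_zero_iff.1 hx).symm⟩
      · rintro ⟨y, rfl⟩
        exact map_zero e

/-- Cutting at the kernel of `ε`, or conversely splicing, reduces long resolutions to short exact
sequences for induction on `k`. -/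
lemma resolDimLE_succ_iff {k : ℕ} {M : ModuleCat.{u} A} :
    resolDimLE P (k + 1) M ↔ ∃ (K F : ModuleCat.{u} A) (i : K →ₗ[A] F) (p : F →ₗ[A] M),
      Function.Injective i ∧ Function.Surjective p ∧ Function.Exact i p ∧
        P F ∧ resolDimLE P k K := by
  constructor
  · rintro ⟨F, ε, d, hF, h1, hε, he, hd⟩
    let ε' : F 1 →ₗ[A] LinearMap.ker ε := LinearMap.codRestrict _ (d 0) he.apply_apply_eq_zero
    refine ⟨ModuleCat.of A (LinearMap.ker ε), F 0, (LinearMap.ker ε).subtype, ε,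
      Subtype.val_injective, hε, LinearMap.exact_subtype_ker_map ε, hF 0 (Nat.zero_le _),
      fun i => F (i + 1), ε', fun i => d (i + 1), fun i hi => hF (i + 1) (by omega), h1, ?_, ?_,
      fun i hi => hd (i + 1) (by omega)⟩
    · rintro ⟨x, hx⟩
      obtain ⟨y, rfl⟩ := (he x).1 hx
      exact ⟨y, rfl⟩
    · intro x
      rw [← hd 0 (by omega) x]
      exact Subtype.ext_iff
  · rintro ⟨K, F, i, p, hi, hp, he, hF, G, ε, d, hG, h1, hε, he', hd⟩
    refine ⟨fun j => Nat.casesOn j F G, p, fun j => Nat.casesOn j (i ∘ₗ ε) d, ?_, h1, hp, ?_, ?_⟩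
    · rintro (_ | j) hj
      · exact hF
      · exact hG j (by omega)
    · intro x
      rw [he x]
      constructor
      · rintro ⟨y, rfl⟩
        obtain ⟨z, rfl⟩ := hε y
        exact ⟨z, rfl⟩
      · rintro ⟨z, rfl⟩
        exact ⟨ε z, rfl⟩
    · rintro (_ | j) hj
      · intro x
        rw [← he' x]
        exact map_eq_zero_iff i hi
      · exact hd j (by omega)

/-- The resolution `M = M` is padded with zero modules, which must therefore belong to `P`. -/
lemma resolDimLE_of_mem (hz : ∀ Z : ModuleCat.{u} A, Subsingleton Z → P Z) (k : ℕ) :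
    P ≤ resolDimLE P k := by
  induction k with
  | zero => exact fun M hM => resolDimLE_zero_iff.2 ⟨M, hM, ⟨LinearEquiv.refl A M⟩⟩
  | succ k ih =>
    intro M hM
    have h : Subsingleton (ModuleCat.of A PUnit.{u + 1}) :=
      inferInstanceAs (Subsingleton PUnit.{u + 1})
    refine resolDimLE_succ_iff.2 ⟨ModuleCat.of A PUnit, M, 0, LinearMap.id,
      Function.injective_of_subsingleton _, Function.surjective_id, ?_, hM, ih _ (hz _ h)⟩
    intro x
    exact ⟨fun hx => ⟨0, hx.symm⟩, fun ⟨_, hy⟩ => hy.symm⟩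

lemma coresolDimLE_zero_iff {M : ModuleCat.{u} A} :
    coresolDimLE P 0 M ↔ ∃ I : ModuleCat.{u} A, P I ∧ Nonempty (M ≃ₗ[A] I) := by
  constructor
  · rintro ⟨I, ε, d, hI, h1, hε, he, -⟩
    have := h1
    exact ⟨I 0, hI 0 le_rfl, ⟨LinearEquiv.ofBijective ε
      ⟨hε, fun x => (he x).1 (Subsingleton.elim (α := I 1) _ _)⟩⟩⟩
  · rintro ⟨I, hI, ⟨e⟩⟩
    refine ⟨fun i => Nat.casesOn i I (fun _ => ModuleCat.of A PUnit), e.toLinearMap,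
      fun _ => 0, ?_, ?_, e.injective, ?_, fun i hi => absurd hi (Nat.not_lt_zero i)⟩
    · intro i hi
      obtain rfl := Nat.le_zero.1 hi
      exact hI
    · exact inferInstanceAs (Subsingleton PUnit)
    · intro x
      exact ⟨fun _ => e.surjective x, fun _ => rfl⟩

lemma coresolDimLE_succ_iff {k : ℕ} {M : ModuleCat.{u} A} :
    coresolDimLE P (k + 1) M ↔ ∃ (I Q : ModuleCat.{u} A) (i : M →ₗ[A] I) (p : I →ₗ[A] Q),
      Function.Injective i ∧ Function.Surjective p ∧ Function.Exact i p ∧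
        P I ∧ coresolDimLE P k Q := by
  constructor
  · rintro ⟨I, ε, d, hI, h1, hε, he, hd⟩
    have hq := Submodule.mkQ_surjective (LinearMap.range ε)
    have hex := LinearMap.exact_map_mkQ_range ε
    -- The coresolution is cut at the cokernel of `ε`, which `d 0` embeds into `I 1`.
    obtain ⟨ε', hε'⟩ := exists_desc_of_exact hq hex (d 0) he.linearMap_comp_eq_zero
    have hε'' : ∀ x, ε' ((LinearMap.range ε).mkQ x) = d 0 x := LinearMap.congr_fun hε'
    refine ⟨I 0, ModuleCat.of A (I 0 ⧸ LinearMap.range ε), ε, (LinearMap.range ε).mkQ,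
      hε, hq, hex, hI 0 (Nat.zero_le _),
      fun i => I (i + 1), ε', fun i => d (i + 1), fun i hi => hI (i + 1) (by omega), h1, ?_, ?_,
      fun i hi => hd (i + 1) (by omega)⟩
    · refine (injective_iff_map_eq_zero _).2 fun x hx => ?_
      obtain ⟨x, rfl⟩ := hq x
      rw [hε'', he x] at hx
      exact (hex x).2 hx
    · intro x
      refine (hd 0 (by omega) x).trans ⟨?_, ?_⟩
      · rintro ⟨y, rfl⟩
        exact ⟨_, hε'' y⟩
      · rintro ⟨y, rfl⟩
        obtain ⟨y, rfl⟩ := hq y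
        exact ⟨y, (hε'' y).symm⟩
  · rintro ⟨I, Q, i, p, hi, hp, he, hI, J, ε, d, hJ, h1, hε, he', hd⟩
    refine ⟨fun j => Nat.casesOn j I J, i, fun j => Nat.casesOn j (ε ∘ₗ p) d, ?_, h1, hi, ?_, ?_⟩
    · rintro (_ | j) hj
      · exact hI
      · exact hJ j (by omega)
    · intro x
      rw [← he x]
      exact map_eq_zero_iff ε hε
    · rintro (_ | j) hj
      · intro x
        refine (he' x).trans ⟨?_, ?_⟩
        · rintro ⟨y, rfl⟩
          obtain ⟨z, rfl⟩ := hp y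
          exact ⟨z, rfl⟩
        · rintro ⟨z, rfl⟩
          exact ⟨p z, rfl⟩
      · exact hd j (by omega)

lemma coresolDimLE_of_mem (hz : ∀ Z : ModuleCat.{u} A, Subsingleton Z → P Z) (k : ℕ) :
    P ≤ coresolDimLE P k := by
  induction k with
  | zero => exact fun M hM => coresolDimLE_zero_iff.2 ⟨M, hM, ⟨LinearEquiv.refl A M⟩⟩
  | succ k ih =>
    intro M hM
    have h : Subsingleton (ModuleCat.of A PUnit.{u + 1}) :=
      inferInstanceAs (Subsingleton PUnit.{u + 1})
    refine coresolDimLE_succ_iff.2 ⟨M, ModuleCat.of A PUnit, LinearMap.id, 0,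
      Function.injective_id, fun x => ⟨0, Subsingleton.elim _ _⟩, ?_, hM, ih _ (hz _ h)⟩
    intro x
    exact ⟨fun _ => ⟨x, rfl⟩, fun _ => rfl⟩

end Dimension

section Transfer

variable {R S C : Type u} [Ring R] [Ring S] [AddCommGroup C] [Module S C] [Module Rᵐᵒᵖ C]
  [SMulCommClass S Rᵐᵒᵖ C] {P : ObjectProperty (ModuleCat.{u} R)}
  {Q : ObjectProperty (ModuleCat.{u} S)}

/-- Membership in `auslander` is carried along the induction: `C ⊗ i` is injective only because `K`
and `F` are known to lie in that class. -/
lemma resolDimLE_tensor (hC : IsFaithfullySemidualizing R S C) (hP : P ≤ auslander R S C)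
    (hPQ : ∀ M, P M → Q ((tensorFunctor R S C).obj M)) (k : ℕ) (M : ModuleCat.{u} R)
    (hM : resolDimLE P k M) :
    auslander R S C M ∧ resolDimLE Q k ((tensorFunctor R S C).obj M) := by
  induction k generalizing M with
  | zero =>
    obtain ⟨F, hF, ⟨e⟩⟩ := resolDimLE_zero_iff.1 hM
    exact ⟨auslander_of_equiv hC.toIsSemidualizing e (hP F hF),
      resolDimLE_zero_iff.2 ⟨_, hPQ F hF, ⟨tensorEquiv S C e⟩⟩⟩
  | succ k ih =>
    obtain ⟨K, F, i, p, hi, hp, he, hF, hK⟩ := resolDimLE_succ_iff.1 hM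
    obtain ⟨hK, hK'⟩ := ih K hK
    obtain ⟨hM, hinj⟩ := auslander_cokernel hC hi hp he hK (hP F hF)
    exact ⟨hM, resolDimLE_succ_iff.2 ⟨_, _, tensorMap R S C i, tensorMap R S C p, hinj,
      tensorMap_surjective hp, tensorMap_exact hp he, hPQ F hF, hK'⟩⟩

lemma resolDimLE_hom (hC : IsSemidualizing R S C) (hQ : Q ≤ bass R S C)
    (hQP : ∀ N, Q N → P ((homFunctor R S C).obj N)) (k : ℕ) (N : ModuleCat.{u} S)
    (hN : resolDimLE Q k N) :
    bass R S C N ∧ resolDimLE P k ((homFunctor R S C).obj N) := by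
  induction k generalizing N with
  | zero =>
    obtain ⟨F, hF, ⟨e⟩⟩ := resolDimLE_zero_iff.1 hN
    exact ⟨bass_of_equiv hC e (hQ F hF),
      resolDimLE_zero_iff.2 ⟨_, hQP F hF, ⟨homEquiv R C e⟩⟩⟩
  | succ k ih =>
    obtain ⟨K, F, i, p, hi, hp, he, hF, hK⟩ := resolDimLE_succ_iff.1 hN
    obtain ⟨hK, hK'⟩ := ih K hK
    obtain ⟨hN, hsurj⟩ := bass_cokernel hC hi hp he hK (hQ F hF)
    exact ⟨hN, resolDimLE_succ_iff.2 ⟨_, _, homMap R S C i, homMap R S C p,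
      homMap_injective hi, hsurj, homMap_exact hi he, hQP F hF, hK'⟩⟩

lemma coresolDimLE_tensor (hC : IsSemidualizing R S C) (hP : P ≤ auslander R S C)
    (hPQ : ∀ M, P M → Q ((tensorFunctor R S C).obj M)) (k : ℕ) (M : ModuleCat.{u} R)
    (hM : coresolDimLE P k M) :
    auslander R S C M ∧ coresolDimLE Q k ((tensorFunctor R S C).obj M) := by
  induction k generalizing M with
  | zero =>
    obtain ⟨I, hI, ⟨e⟩⟩ := coresolDimLE_zero_iff.1 hM
    exact ⟨auslander_of_equiv hC e.symm (hP I hI),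
      coresolDimLE_zero_iff.2 ⟨_, hPQ I hI, ⟨tensorEquiv S C e⟩⟩⟩
  | succ k ih =>
    obtain ⟨I, Z, i, p, hi, hp, he, hI, hZ⟩ := coresolDimLE_succ_iff.1 hM
    obtain ⟨hZ, hZ'⟩ := ih Z hZ
    obtain ⟨hM, hinj⟩ := auslander_kernel hC hi hp he (hP I hI) hZ
    exact ⟨hM, coresolDimLE_succ_iff.2 ⟨_, _, tensorMap R S C i, tensorMap R S C p, hinj,
      tensorMap_surjective hp, tensorMap_exact hp he, hPQ I hI, hZ'⟩⟩

/-- Here the delicate point is surjectivity of `Hom(C, p)`, supplied by `bass_kernel` once the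
cokernel `Z` is known to lie in `bass`. -/
lemma coresolDimLE_hom (hC : IsFaithfullySemidualizing R S C) (hQ : Q ≤ bass R S C)
    (hQP : ∀ N, Q N → P ((homFunctor R S C).obj N)) (k : ℕ) (N : ModuleCat.{u} S)
    (hN : coresolDimLE Q k N) :
    bass R S C N ∧ coresolDimLE P k ((homFunctor R S C).obj N) := by
  induction k generalizing N with
  | zero =>
    obtain ⟨I, hI, ⟨e⟩⟩ := coresolDimLE_zero_iff.1 hN
    exact ⟨bass_of_equiv hC.toIsSemidualizing e.symm (hQ I hI),
      coresolDimLE_zero_iff.2 ⟨_, hQP I hI, ⟨homEquiv R C e⟩⟩⟩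
  | succ k ih =>
    obtain ⟨I, Z, i, p, hi, hp, he, hI, hZ⟩ := coresolDimLE_succ_iff.1 hN
    obtain ⟨hZ, hZ'⟩ := ih Z hZ
    obtain ⟨hN, hsurj⟩ := bass_kernel hC hi hp he (hQ I hI) hZ
    exact ⟨hN, coresolDimLE_succ_iff.2 ⟨_, _, homMap R S C i, homMap R S C p,
      homMap_injective hi, hsurj, homMap_exact hi he, hQP I hI, hZ'⟩⟩

lemma CfpF_le_bass (hC : IsSemidualizing R S C) (n : ℕ) : CfpF R S C n ≤ bass R S C := by
  rintro N ⟨Y, hY, ⟨e⟩⟩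
  exact bass_of_equiv hC e.toLinearEquiv.symm (bass_tensor hC (fpF_le_auslander hC n Y hY))

lemma CfpI_le_auslander (hC : IsSemidualizing R S C) (n : ℕ) :
    CfpI R S C n ≤ auslander R S C := by
  rintro M ⟨X, hX, ⟨e⟩⟩
  exact auslander_of_equiv hC e.toLinearEquiv.symm (auslander_hom (fpI_le_bass hC n X hX))

lemma fpF_hom_of_CfpF (hC : IsSemidualizing R S C) (n : ℕ) (N : ModuleCat.{u} S)
    (hN : CfpF R S C n N) : fpF R n ((homFunctor R S C).obj N) := by
  obtain ⟨Y, hY, ⟨e⟩⟩ := hN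
  let e₁ : Y ≃ₗ[R] HomS S C (Tens R C Y) :=
    LinearEquiv.ofBijective _ (fpF_le_auslander hC n Y hY).2.2
  exact fpF_of_equiv (e₁.trans (homEquiv R C e.toLinearEquiv.symm)) hY

lemma fpI_tensor_of_CfpI (hC : IsSemidualizing R S C) (n : ℕ) (M : ModuleCat.{u} R)
    (hM : CfpI R S C n M) : fpI S n ((tensorFunctor R S C).obj M) := by
  obtain ⟨X, hX, ⟨e⟩⟩ := hM
  let e₁ : Tens R C (HomS S C X) ≃ₗ[S] X :=
    LinearEquiv.ofBijective _ (fpI_le_bass hC n X hX).2.2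
  exact fpI_of_equiv (e₁.symm.trans (tensorEquiv S C e.toLinearEquiv.symm)) hX

lemma CfpF_of_subsingleton (n : ℕ) (N : ModuleCat.{u} S) (hN : Subsingleton N) :
    CfpF R S C n N := by
  have h : Subsingleton (ModuleCat.of R PUnit.{u + 1}) :=
    inferInstanceAs (Subsingleton PUnit.{u + 1})
  have h' : Subsingleton ((tensorFunctor R S C).obj (ModuleCat.of R PUnit.{u + 1})) :=
    Tens.subsingleton_right (R := R) (K := C) (M := PUnit.{u + 1})
  exact ⟨ModuleCat.of R PUnit, fpF_of_subsingleton n _,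
    ⟨(ModuleCat.isZero_of_subsingleton _).iso (ModuleCat.isZero_of_subsingleton _)⟩⟩

lemma CfpI_of_subsingleton (n : ℕ) (M : ModuleCat.{u} R) (hM : Subsingleton M) :
    CfpI R S C n M := by
  have h : Subsingleton (ModuleCat.of S PUnit.{u + 1}) :=
    inferInstanceAs (Subsingleton PUnit.{u + 1})
  have h' : Subsingleton ((homFunctor R S C).obj (ModuleCat.of S PUnit.{u + 1})) :=
    inferInstanceAs (Subsingleton (C →ₗ[S] PUnit.{u + 1}))
  exact ⟨ModuleCat.of S PUnit, fpI_of_subsingleton n _,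
    ⟨(ModuleCat.isZero_of_subsingleton _).iso (ModuleCat.isZero_of_subsingleton _)⟩⟩

/-! ### Equivalences -/

/-- Classes contained in the Auslander and Bass classes that are mapped to each other by
`C ⊗_R -` and `Hom_S(C, -)` are equivalent. -/
def InducedEquivalence.ofLE (hP : P ≤ auslander R S C) (hQ : Q ≤ bass R S C)
    (hPQ : ∀ M, P M → Q ((tensorFunctor R S C).obj M))
    (hQP : ∀ N, Q N → P ((homFunctor R S C).obj N)) : InducedEquivalence R S C P Q where
  tensor_mem := hPQ
  hom_mem := hQP
  unitIso := NatIso.ofComponents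
    (fun M => P.isoMk (LinearEquiv.ofBijective (mu R S C M.obj)
      (hP _ M.property).2.2).toModuleIso)
    (fun _ => ObjectProperty.hom_ext _ rfl)
  counitIso := NatIso.ofComponents
    (fun N => Q.isoMk (LinearEquiv.ofBijective (nu R S C N.obj)
      (hQ _ N.property).2.2).toModuleIso)
    (fun f => ObjectProperty.hom_ext _ (ModuleCat.hom_ext (LinearMap.ext
      (nu_tensorMap_homMap f.hom.hom))))
  unit_app _ := rfl
  counit_app _ := rfl

/-- All restrictions come from the same two ambient functors, so the squares commute strictly. -/
lemma Compatible.of_le {P' : ObjectProperty (ModuleCat.{u} R)}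
    {Q' : ObjectProperty (ModuleCat.{u} S)} (E : InducedEquivalence R S C P Q)
    (E' : InducedEquivalence R S C P' Q') (hP : P ≤ P') (hQ : Q ≤ Q') : Compatible E E' :=
  ⟨hP, hQ, rfl, rfl⟩

end Transfer

end

end Foxby

open Foxby

theorem theorem4p5 (R S C : Type u) [Ring R] [Ring S] [AddCommGroup C] [Module S C]
    [Module Rᵐᵒᵖ C] [SMulCommClass S Rᵐᵒᵖ C]
    (hC : Foxby.IsFaithfullySemidualizing R S C) (n : ℕ) (hn : 1 ≤ n) (k : ℕ) :
    ∃ (E_F : Foxby.InducedEquivalence R S C (Foxby.fpF R n) (Foxby.CfpF R S C n))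
      (E_Fk : Foxby.InducedEquivalence R S C (Foxby.fpFLE R n k) (Foxby.CfpFLE R S C n k))
      (E : Foxby.InducedEquivalence R S C (Foxby.auslander R S C) (Foxby.bass R S C))
      (E_Ik : Foxby.InducedEquivalence R S C (Foxby.CfpILE R S C n k) (Foxby.fpILE S n k))
      (E_I : Foxby.InducedEquivalence R S C (Foxby.CfpI R S C n) (Foxby.fpI S n)),
      Foxby.Compatible E_F E_Fk ∧ Foxby.Compatible E_Fk E ∧
      Foxby.Compatible E_I E_Ik ∧ Foxby.Compatible E_Ik E := by
  have hC' := hC.toIsSemidualizing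
  have hF := fpF_le_auslander hC' n
  have hCF := CfpF_le_bass hC' n
  have hI := fpI_le_bass hC' n
  have hCI := CfpI_le_auslander hC' n
  have tF : ∀ M, fpF R n M → CfpF R S C n ((tensorFunctor R S C).obj M) :=
    fun M hM => ⟨M, hM, ⟨Iso.refl _⟩⟩
  have tI : ∀ N, fpI S n N → CfpI R S C n ((homFunctor R S C).obj N) :=
    fun N hN => ⟨N, hN, ⟨Iso.refl _⟩⟩
  have hF' := fpF_hom_of_CfpF hC' n
  have hI' := fpI_tensor_of_CfpI hC' n
  have rF := resolDimLE_tensor hC hF tF k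
  have rCF := resolDimLE_hom hC' hCF hF' k
  have rI := coresolDimLE_hom hC hI tI k
  have rCI := coresolDimLE_tensor hC' hCI hI' k
  refine ⟨.ofLE hF hCF tF hF',
    .ofLE (fun M hM => (rF M hM).1) (fun N hN => (rCF N hN).1) (fun M hM => (rF M hM).2)
      (fun N hN => (rCF N hN).2),
    .ofLE le_rfl le_rfl (fun M hM => bass_tensor hC' hM) (fun N hN => auslander_hom hN),
    .ofLE (fun M hM => (rCI M hM).1) (fun N hN => (rI N hN).1) (fun M hM => (rCI M hM).2)
      (fun N hN => (rI N hN).2),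
    .ofLE hCI hI hI' tI, ?_, ?_, ?_, ?_⟩
  · exact .of_le _ _ (resolDimLE_of_mem (fun Z _ => fpF_of_subsingleton n Z) k)
      (resolDimLE_of_mem (CfpF_of_subsingleton n) k)
  · exact .of_le _ _ (fun M hM => (rF M hM).1) (fun N hN => (rCF N hN).1)
  · exact .of_le _ _ (coresolDimLE_of_mem (CfpI_of_subsingleton n) k)
      (coresolDimLE_of_mem (fun Z _ => fpI_of_subsingleton n Z) k)
  · exact .of_le _ _ (fun M hM => (rCI M hM).1) (fun N hN => (rI N hN).1)
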